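/- Conventions. All spaces are complex. For $1\le p\le q<\infty$, a bounded operator $T\colon E\to G$ between Banach spaces is $(q,p)$-summing, $T\in\Pi_{q,p}(E,G)$, if there is $C>0$ with $$\Big(\sum_{k=1}^n\|Tx_k\|^q\Big)^{1/q}\le C\,\sup_{\|x^*\|_{E^*}\le1}\Big(\sum_{k=1}^n|\langle x^*,x_k\rangle|^p\Big)^{1/p}$$ for all finite families $x_1,\dots,x_n\in E$; $\Pi_p=\Pi_{p,p}$. We write $\ell_p^w(E)$ for the weakly $p$-summable sequences in $E$, and $q'$ for the conjugate exponent of $q$. Let $(\Omega,\mathfrak M,\mu)$ be a measure space and $E$, $F$ Banach spaces. If $\alpha$ is a norm on $E\otimes F$ and $V$ is a space of operators from $E$ to $F^*$ that is the dual of the completion $E\widehat\otimes_\alpha F$ through $\langle T,x\otimes y\rangle=\langle Tx,y\rangle$, a $V$-valued function $\mathscr A$ on $\Omega$ (it is enough that $\mathscr A_t\in V$ for almost every $t$) is weakly$^*$ (or Gel'fand) integrable if $t\mapsto\langle\mathscr A_t,z\rangle$ is $\mu$-integrable for every $z\in E\widehat\otimes_\alpha F$; its Gel'fand integral over $S\in\mathfrak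 M$ is the $\int_S\mathscr A\,d\mu\in V$ with $\langle\int_S\mathscr A\,d\mu,z\rangle=\int_S\langle\mathscr A_t,z\rangle\,d\mu(t)$ for all $z$. For $V=\mathcal B(E,F^*)$, $\alpha$ is the projective norm. For $V=\Pi_p(E,F^*)$, $\alpha$ is the Chevet–Saphar norm $$d_{p'}(z)=\inf\Big\{\sup_{\|x^*\|\le1}\Big(\sum_j|\langle x^*,x_j\rangle|^p\Big)^{1/p}\,\big\|(\|y_j\|)_j\big\|_{\ell_{p'}}: z=\sum_{j=1}^n x_j\otimes y_j\Big\}.$$ Theorem. Let $K$ be a compact space, $(X,\nu)$ and $(\Omega,\mathfrak M,\mu)$ measure spaces and $1\le p\le q<\infty$. Identify $L_q(X,\nu)$ with $F^*$ as follows: if $q>1$, then $F=L_{q'}(X,\nu)$ with the pairing $\langle g,y\rangle=\int_X gy\,d\nu$; if $q=1$, assume that $F$ is a Banach lattice whose dual Banach lattice is $L_1(X,\nu)$. Let $\mathscr A\colon\Omega\to\mathcal B(C(K),L_q(X,\nu))$ be weakly$^*$ integrable, and let $\mathscr A_t$ be a positive operator (that is, $\mathscr A_tf\ge0$ whenever $f\ge0$)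 for almost every $t\in\Omega$. Then: 1. For every $S\in\mathfrak M$ the Gel'fand integral $\int_S\mathscr A\,d\mu\in\mathcal B(C(K),L_q(X,\nu))$ exists, is unique, and belongs to $\Pi_{q,p}(C(K),L_q(X,\nu))$. 2. For all $(f_n)_{n=1}^\infty\in\ell_p^w(C(K))$ and $(\varphi_n)_{n=1}^\infty\in\ell_{q'}(F)$, $$\sum_{n=1}^\infty|\langle\mathscr A_tf_n,\varphi_n\rangle|\in L_1(\Omega,\mathfrak M,\mu).$$ 3. If $p=q$, then $\mathscr A_t\in\Pi_p(C(K),L_p(X,\nu))$ for almost every $t$, and $\mathscr A$ is Gel'fand integrable as a $\Pi_p(C(K),L_p(X,\nu))$-valued function. -/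

import Mathlib

open MeasureTheory Filter Topology
open scoped ENNReal TensorProduct ComplexOrder

noncomputable section

namespace GelfandSumming

section Sequences

variable {E : Type*} [NormedAddCommGroup E] [NormedSpace ℂ E]

/-- The weak `ℓ_p`-norm `(sup_{‖y‖ ≤ 1} ∑ |⟨y, x_k⟩|^p)^{1/p}` of a finite sequence,
the supremum running over the closed unit ball of the dual space. -/
def weakNorm (p : ℝ≥0∞) {n : ℕ} (x : Fin n → E) : ℝ :=
  (⨆ y : Metric.closedBall (0 : StrongDual ℂ E) 1,
    ∑ k, ‖(y : StrongDual ℂ E) (x k)‖ ^ p.toReal) ^ (1 / p.toReal)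

/-- Weakly `p`-summable sequences (`p < ∞`). -/
def WeaklySummable (p : ℝ≥0∞) (x : ℕ → E) : Prop :=
  ∀ y : StrongDual ℂ E, Summable fun n => ‖y (x n)‖ ^ p.toReal

end Sequences

section Operators

variable {E G : Type*} [NormedAddCommGroup E] [NormedSpace ℂ E]
  [NormedAddCommGroup G] [NormedSpace ℂ G]

/-- `T ∈ Π_{q,p}(E, G)`: the operator `T` is `(q,p)`-summing (`p, q < ∞`). -/
def IsSumming (q p : ℝ≥0∞) (T : E →L[ℂ] G) : Prop :=
  ∃ C : ℝ, 0 < C ∧ ∀ (n : ℕ) (x : Fin n → E),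
    (∑ k, ‖T (x k)‖ ^ q.toReal) ^ (1 / q.toReal) ≤ C * weakNorm p x

end Operators

section Tensor

variable {E F : Type*} [NormedAddCommGroup E] [NormedSpace ℂ E]
  [NormedAddCommGroup F] [NormedSpace ℂ F]

/-- The projective norm on the algebraic tensor product `E ⊗ F`. -/
def projNorm (z : E ⊗[ℂ] F) : ℝ :=
  sInf {r : ℝ | ∃ (n : ℕ) (x : Fin n → E) (y : Fin n → F),
    z = ∑ j, x j ⊗ₜ[ℂ] y j ∧ r = ∑ j, ‖x j‖ * ‖y j‖}

/-- The Chevet-Saphar norm `d_{p'}` on `E ⊗ F`, where `p'` is the conjugate exponent of `p`: the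
infimum of `‖(x_j)‖_{p,w} * ‖(y_j)‖_{p'}` over all representations `z = ∑ x_j ⊗ y_j`. -/
def chevetSaphar (p p' : ℝ≥0∞) (z : E ⊗[ℂ] F) : ℝ :=
  sInf {r : ℝ | ∃ (n : ℕ) (x : Fin n → E) (y : Fin n → F),
    z = ∑ j, x j ⊗ₜ[ℂ] y j ∧ r = weakNorm p x * ‖(WithLp.toLp p' y : PiLp p' fun _ => F)‖}

/-- A sequence in `E ⊗ F` that is Cauchy for the norm `α`; such sequences represent the elements
of the completion of `E ⊗ F` under `α`. -/
def IsCauchyFor (α : E ⊗[ℂ] F → ℝ) (z : ℕ → E ⊗[ℂ] F) : Prop :=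
  ∀ ε : ℝ, 0 < ε → ∃ N : ℕ, ∀ m ≥ N, ∀ n ≥ N, α (z m - z n) < ε

/-- The linear functional on `E ⊗ F` given by an operator `T : E → F^*`, with
`⟨T, x ⊗ y⟩ = ⟨T x, y⟩`. -/
def tensorPairing (T : E →L[ℂ] StrongDual ℂ F) : E ⊗[ℂ] F →ₗ[ℂ] ℂ :=
  TensorProduct.lift T.toLinearMap₁₂

variable {Ω : Type*} [MeasurableSpace Ω]

/-- Weak* (Gel'fand) integrability of an operator-valued function `A : Ω → B(E, F^*)` with respect
to the predual obtained by completing `E ⊗ F` under `α`: for every element `z` of the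
completion, represented by a Cauchy sequence `(z_k)`, the scalar function
`t ↦ ⟨A_t, z⟩ = lim_k ⟨A_t, z_k⟩` (which is required to be defined almost everywhere)
is integrable. -/
def IsGelfandIntegrable (α : E ⊗[ℂ] F → ℝ) (μ : Measure Ω)
    (A : Ω → E →L[ℂ] StrongDual ℂ F) : Prop :=
  ∀ z : ℕ → E ⊗[ℂ] F, IsCauchyFor α z → ∃ g : Ω → ℂ, Integrable g μ ∧
    ∀ᵐ t ∂μ, Tendsto (fun k => tensorPairing (A t) (z k)) atTop (𝓝 (g t))

/-- `T` is the Gel'fand integral of `A` over `S` with respect to the completion of `E ⊗ F`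
under `α`: `⟨T, z⟩ = ∫_S ⟨A_t, z⟩ dμ(t)` for every element `z` of the completion. -/
def IsGelfandIntegral (α : E ⊗[ℂ] F → ℝ) (μ : Measure Ω)
    (A : Ω → E →L[ℂ] StrongDual ℂ F) (S : Set Ω) (T : E →L[ℂ] StrongDual ℂ F) : Prop :=
  ∀ z : ℕ → E ⊗[ℂ] F, IsCauchyFor α z → ∃ g : Ω → ℂ, Integrable g μ ∧
    (∀ᵐ t ∂μ, Tendsto (fun k => tensorPairing (A t) (z k)) atTop (𝓝 (g t))) ∧
    Tendsto (fun k => tensorPairing T (z k)) atTop (𝓝 (∫ t in S, g t ∂μ))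

/-- Condition on `A : Ω → B(E, F^*)`: for all weakly `p`-summable `(x_n)` in `E` and all
`(y_n) ∈ ℓ_{q'}(F)` the function `t ↦ ∑ |⟨A_t x_n, y_n⟩|` belongs to `L_1(μ)` (in particular, it
is finite almost everywhere). -/
def SummabilityCondition (p q' : ℝ≥0∞) (μ : Measure Ω)
    (A : Ω → E →L[ℂ] StrongDual ℂ F) : Prop :=
  ∀ (x : ℕ → E) (y : ℕ → F), WeaklySummable p x → Memℓp (E := fun _ => F) y q' →
    (∀ᵐ t ∂μ, Summable fun n => ‖A t (x n) (y n)‖) ∧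
    Integrable (fun t => ∑' n, ‖A t (x n) (y n)‖) μ

end Tensor

section LqSpaces

variable {X : Type*} [MeasurableSpace X] {ν : Measure X} {q : ℝ≥0∞} [Fact (1 ≤ q)]

/-- Positive operators from `C(K)` to `L_q(X, ν)`. -/
def IsPositiveOp {K : Type*} [TopologicalSpace K] [CompactSpace K]
    (T : C(K, ℂ) →L[ℂ] Lp ℂ q ν) : Prop :=
  ∀ f : C(K, ℂ), (∀ s, 0 ≤ f s) → ∀ᵐ x ∂ν, 0 ≤ (T f : X → ℂ) x

variable {F : Type*} [NormedAddCommGroup F] [NormedSpace ℂ F]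

/-- `Φ` is the identification of `L_q(X, ν)` with `F^*`, as follows.

* For `1 < q`, the space `F` is `L_{q'}(X, ν)` and the pairing is `⟨g, y⟩ = ∫ g y dν`.
* For `q = 1`, `F` is a Banach lattice whose dual Banach lattice is `L_1(X, ν)`: `Φ` is
  isometric and onto, and for all `y ∈ F` the modulus `z = |y|`, given by
  `⟨g, |y|⟩ = sup {|⟨h, y⟩| : h ∈ L_1(X, ν), |h| ≤ g}` for `0 ≤ g ∈ L_1(X, ν)`,
  belongs to `F`. -/
def IsLqDuality (q' : ℝ≥0∞) [Fact (1 ≤ q')] (Φ : Lp ℂ q ν →L[ℂ] StrongDual ℂ F) : Prop :=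
  (1 < q ∧ ∃ e : F ≃ₗᵢ[ℂ] Lp ℂ q' ν,
    ∀ (g : Lp ℂ q ν) (y : F), Φ g y = ∫ x, (g : X → ℂ) x * (e y : X → ℂ) x ∂ν) ∨
  (q = 1 ∧ (∀ g, ‖Φ g‖ = ‖g‖) ∧ Function.Surjective Φ ∧
    ∀ y : F, ∃ z : F, ∀ g : Lp ℂ q ν, (∀ᵐ x ∂ν, 0 ≤ (g : X → ℂ) x) →
      ∃ r : ℝ, Φ g z = (r : ℂ) ∧
        IsLUB {s : ℝ | ∃ h : Lp ℂ q ν,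
          (∀ᵐ x ∂ν, ‖(h : X → ℂ) x‖ ≤ ‖(g : X → ℂ) x‖) ∧ s = ‖Φ h y‖} r)

end LqSpaces

end GelfandSumming

end

/-!
Besides being isometric and onto, the identification of `L_q` with `F^*` enters only through one
lattice fact, `IsLqDuality.exists_dominating`: every finite family `(y_k)` in `F` has a dominating
element `v`, of norm at most `‖(‖y_k‖)‖_{q'}`, such that `∑ |⟨h_k, y_k⟩| ≤ Re ⟨g, v⟩` whenever
`0 ≤ g` and `(∑ |h_k|^q)^{1/q} ≤ g` almost everywhere. For `q > 1` one takes
`v = (∑ |y_k|^{q'})^{1/q'}` and applies Hölder's inequality. For `q = 1` one takes for `v` the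
supremum of the moduli `|y_k|`, built from `z ∨ w = (z + w + |z - w|) / 2`; its norm is at most the
maximum of the norms because the norm of `L_1` is additive on the positive cone (`exists_sup`).

A positive operator `T` on `C(K)` satisfies `(∑ |T f_k|^q)^{1/q} ≤ M · T 1` almost everywhere
whenever `(∑ |f_k|^q)^{1/q} ≤ M` on `K` (`IsPositiveOp.norm_toLp_le`). With `h_k = A_t f_k` and
`g = M · A_t 1` this gives `∑ |⟨A_t f_k, y_k⟩| ≤ M Re ⟨A_t 1, v⟩` for almost every `t`. By the
closed graph theorem `∫ |⟨A_t 1, v⟩| dμ(t) ≤ C ‖v‖` (`exists_integral_norm_le`), so that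
`∑ ∫ |⟨A_t f_k, y_k⟩| dμ(t) ≤ C M ‖(‖y_k‖)‖_{q'}` (`exists_integral_sum_norm_le`). This estimate
carries all three assertions.

* It bounds the bilinear form `(f, y) ↦ ∫_S ⟨A_t f, y⟩ dμ(t)`, hence gives the integral as an
  operator into `F^* = L_q`, and it is the dual form of the `(q,p)`-summing inequality for this
  operator (`IsLqDuality.isSumming`).
* Applied to the initial segments of two sequences, it gives the summability condition, since
  weakly `p`-summable sequences have bounded weak `ℓ_p`-norm (`WeaklySummable.exists_bound`).
* For `p = q` it says that `z ↦ ⟨A_t, z⟩` is bounded from `C(K) ⊗ F` with the Chevet-Saphar norm to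
  `L_1(μ)`, while the pointwise estimate makes almost every `A_t` `p`-summing; so the pairing
  extends to the completion (`integrable_and_tendsto_of_isCauchyFor`).

That `L_q` is all of the dual of `L_{q'}` for `1 < q < ∞`, over an arbitrary measure space, is
proved without the Radon-Nikodym theorem (`surjective_lqPairing`). The pairing is isometric, so its
range is closed. If a functional `ψ` of norm one almost attains its norm at `y`, then `ψ` is close
to the image of `y` under the duality map `y ↦ |y|^{q'-2} ȳ`, by convexity of `|·|^{q'}` and
uniform continuity of the duality map on bounded sets; so the range is dense.
-/

namespace GelfandSumming

/-! ### Finite sequences and `ℓ_q`-norms -/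

section FiniteSequences

variable {ι : Type*} [Fintype ι] {E : Type*} [NormedAddCommGroup E]

theorem toReal_pos_of_one_le {p : ℝ≥0∞} (hp : 1 ≤ p) (hp' : p ≠ ∞) : 0 < p.toReal :=
  ENNReal.toReal_pos (zero_lt_one.trans_le hp).ne' hp'

theorem norm_toLp_eq_sum {p : ℝ≥0∞} (hp : 1 ≤ p) (hp' : p ≠ ∞) (a : ι → E) :
    ‖(WithLp.toLp p a : PiLp p fun _ => E)‖ = (∑ k, ‖a k‖ ^ p.toReal) ^ (1 / p.toReal) :=
  PiLp.norm_eq_sum (toReal_pos_of_one_le hp hp') _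

theorem norm_toLp_rpow {p : ℝ≥0∞} (hp : 1 ≤ p) (hp' : p ≠ ∞) (a : ι → E) :
    ‖(WithLp.toLp p a : PiLp p fun _ => E)‖ ^ p.toReal = ∑ k, ‖a k‖ ^ p.toReal := by
  have h0 := toReal_pos_of_one_le hp hp'
  rw [norm_toLp_eq_sum hp hp', ← Real.rpow_mul (by positivity), one_div_mul_cancel h0.ne',
    Real.rpow_one]

theorem norm_toLp_mono {E' : Type*} [NormedAddCommGroup E'] {p : ℝ≥0∞} (hp : 1 ≤ p)
    {a : ι → E} {b : ι → E'} (hab : ∀ k, ‖a k‖ ≤ ‖b k‖) :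
    ‖(WithLp.toLp p a : PiLp p fun _ => E)‖ ≤ ‖(WithLp.toLp p b : PiLp p fun _ => E')‖ := by
  rcases eq_or_ne p ∞ with rfl | hp'
  · rw [PiLp.norm_eq_ciSup, PiLp.norm_eq_ciSup]
    exact ciSup_mono (Set.finite_range _).bddAbove hab
  · rw [norm_toLp_eq_sum hp hp', norm_toLp_eq_sum hp hp']
    gcongr
    exact hab _

/-- The `ℓ_p`-norms decrease in `p`. -/
theorem norm_toLp_antitone {p q : ℝ≥0∞} (hp : 1 ≤ p) (hpq : p ≤ q) (hq : q ≠ ∞) (a : ι → E) :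
    ‖(WithLp.toLp q a : PiLp q fun _ => E)‖ ≤ ‖(WithLp.toLp p a : PiLp p fun _ => E)‖ := by
  have hp' : p ≠ ∞ := ne_top_of_le_ne_top hq hpq
  have p0 := toReal_pos_of_one_le hp hp'
  have q0 := toReal_pos_of_one_le (hp.trans hpq) hq
  have hpq' : p.toReal ≤ q.toReal := ENNReal.toReal_mono hq hpq
  have : Fact (1 ≤ p) := ⟨hp⟩
  have : Fact (1 ≤ q) := ⟨hp.trans hpq⟩
  set N := ‖(WithLp.toLp p a : PiLp p fun _ => E)‖ with hN
  have ha : ∀ k, ‖a k‖ ≤ N := fun k => by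
    simpa using PiLp.norm_apply_le (WithLp.toLp p a : PiLp p fun _ => E) k
  have N0 : 0 ≤ N := norm_nonneg _
  rw [← Real.rpow_le_rpow_iff (norm_nonneg _) N0 q0, norm_toLp_rpow (hp.trans hpq) hq]
  calc ∑ k, ‖a k‖ ^ q.toReal
      = ∑ k, ‖a k‖ ^ p.toReal * ‖a k‖ ^ (q.toReal - p.toReal) := by
        refine Finset.sum_congr rfl fun k _ => ?_
        rw [← Real.rpow_add_of_nonneg (norm_nonneg _) p0.le (by linarith)]
        congr 1; ring
    _ ≤ ∑ k, ‖a k‖ ^ p.toReal * N ^ (q.toReal - p.toReal) := by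
        refine Finset.sum_le_sum fun k _ => mul_le_mul_of_nonneg_left ?_ (by positivity)
        exact Real.rpow_le_rpow (norm_nonneg _) (ha k) (by linarith)
    _ = N ^ q.toReal := by
        rw [← Finset.sum_mul, ← norm_toLp_rpow hp hp', ← hN,
          ← Real.rpow_add_of_nonneg N0 p0.le (by linarith)]
        congr 1; ring

theorem norm_toLp_one (a : ι → E) :
    ‖(WithLp.toLp 1 a : PiLp 1 fun _ => E)‖ = ∑ k, ‖a k‖ := by
  rw [norm_toLp_eq_sum le_rfl (by simp)]; simp

theorem conj_eq_top {q q' : ℝ≥0∞} [ENNReal.HolderConjugate q q'] : q' = ∞ ↔ q = 1 :=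
  haveI : ENNReal.HolderConjugate q' q := ENNReal.HolderConjugate.symm
  ENNReal.HolderConjugate.eq_top_iff_eq_one q' q

/-- Hölder's inequality for finite sequences. -/
theorem sum_norm_mul_norm_le {E' : Type*} [NormedAddCommGroup E'] {q q' : ℝ≥0∞}
    [ENNReal.HolderConjugate q q'] (hq : q ≠ ∞) (a : ι → E) (c : ι → E') :
    ∑ k, ‖a k‖ * ‖c k‖ ≤ ‖(WithLp.toLp q a : PiLp q fun _ => E)‖ *
      ‖(WithLp.toLp q' c : PiLp q' fun _ => E')‖ := by
  have h1 := ENNReal.HolderConjugate.one_le q q'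
  have : ENNReal.HolderConjugate q' q := ENNReal.HolderConjugate.symm
  have h1' := ENNReal.HolderConjugate.one_le q' q
  by_cases hq1 : q = 1
  · obtain rfl : q' = ∞ := (conj_eq_top (q := q)).2 hq1
    subst hq1
    rw [norm_toLp_one, Finset.sum_mul]
    gcongr with k
    simpa using PiLp.norm_apply_le (WithLp.toLp ∞ c : PiLp ∞ fun _ => E') k
  · have hq' : q' ≠ ∞ := fun h => hq1 (conj_eq_top.1 h)
    rw [norm_toLp_eq_sum h1 hq, norm_toLp_eq_sum h1' hq']
    have := Real.inner_le_Lp_mul_Lq Finset.univ (fun k => ‖a k‖) (fun k => ‖c k‖)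
      (ENNReal.HolderConjugate.toReal_of_ne_top hq hq')
    simpa using this

/-- The `ℓ_q`-norm is dual to the `ℓ_{q'}`-norm. -/
theorem norm_toLp_le_of_forall {q q' : ℝ≥0∞}
    [ENNReal.HolderConjugate q q'] (hq : q ≠ ∞) (a : ι → E) {D : ℝ} (hD : 0 ≤ D)
    (h : ∀ c : ι → ℝ, (∀ k, 0 ≤ c k) →
      ∑ k, c k * ‖a k‖ ≤ D * ‖(WithLp.toLp q' c : PiLp q' fun _ => ℝ)‖) :
    ‖(WithLp.toLp q a : PiLp q fun _ => E)‖ ≤ D := by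
  have h1 := ENNReal.HolderConjugate.one_le q q'
  have : ENNReal.HolderConjugate q' q := ENNReal.HolderConjugate.symm
  have h1' := ENNReal.HolderConjugate.one_le q' q
  by_cases hq1 : q = 1
  · obtain rfl : q' = ∞ := (conj_eq_top (q := q)).2 hq1
    subst hq1
    rw [norm_toLp_one]
    have h2 := h (fun _ => 1) fun _ => zero_le_one
    simp only [one_mul] at h2
    refine h2.trans (mul_le_of_le_one_right hD ?_)
    rw [PiLp.norm_eq_ciSup]
    exact Real.iSup_le (fun _ => by simp) zero_le_one
  · have hq' : q' ≠ ∞ := fun h => hq1 (conj_eq_top.1 h)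
    have hc := ENNReal.HolderConjugate.toReal_of_ne_top (p := q) (q := q') hq hq'
    rw [norm_toLp_eq_sum h1 hq]
    obtain ⟨⟨g, hg, hg'⟩, -⟩ := NNReal.isGreatest_Lp Finset.univ (fun k => ‖a k‖₊) hc
    have h3 : (∑ k, ‖a k‖ ^ q.toReal) ^ (1 / q.toReal) = ∑ k, (g k : ℝ) * ‖a k‖ := by
      have := congrArg NNReal.toReal hg'
      push_cast at this
      rw [← this]
      exact Finset.sum_congr rfl fun k _ => mul_comm _ _
    rw [h3]
    refine (h (fun k => (g k : ℝ)) fun k => (g k).2).trans (mul_le_of_le_one_right hD ?_)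
    rw [norm_toLp_eq_sum h1' hq']
    refine Real.rpow_le_one (by positivity) ?_ (by positivity)
    have hg2 : ((∑ k, g k ^ q'.toReal : NNReal) : ℝ) ≤ 1 := by exact_mod_cast hg
    simpa using hg2

theorem norm_toLp_fin_one {p : ℝ≥0∞} (hp : 1 ≤ p) (y : E) :
    ‖(WithLp.toLp p (fun _ => y) : PiLp p fun _ : Fin 1 => E)‖ = ‖y‖ := by
  rcases eq_or_ne p ∞ with rfl | hp'
  · simp [PiLp.norm_eq_ciSup]
  · rw [norm_toLp_eq_sum hp hp', Fin.sum_univ_one, ← Real.rpow_mul (norm_nonneg _),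
      mul_one_div_cancel (toReal_pos_of_one_le hp hp').ne', Real.rpow_one]

/-- The initial segments of an `ℓ_p`-sequence have bounded `ℓ_p`-norms. -/
theorem exists_norm_toLp_initial_le {p : ℝ≥0∞} (hp : 1 ≤ p) {y : ℕ → E}
    (hy : Memℓp (E := fun _ => E) y p) :
    ∃ D : ℝ, 0 ≤ D ∧ ∀ N : ℕ,
      ‖(WithLp.toLp p (fun k : Fin N => y k) : PiLp p fun _ => E)‖ ≤ D := by
  rcases eq_or_ne p ∞ with h | h
  · subst h
    obtain ⟨D, hD⟩ := memℓp_infty_iff.1 hy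
    refine ⟨max D 0, le_max_right _ _, fun N => ?_⟩
    rw [PiLp.norm_eq_ciSup]
    exact Real.iSup_le (fun k => (hD ⟨k, rfl⟩).trans (le_max_left _ _)) (le_max_right _ _)
  · refine ⟨(∑' n, ‖y n‖ ^ p.toReal) ^ (1 / p.toReal), by positivity, fun N => ?_⟩
    rw [norm_toLp_eq_sum hp h]
    gcongr
    rw [Fin.sum_univ_eq_sum_range (fun n => ‖y n‖ ^ p.toReal)]
    exact (hy.summable (toReal_pos_of_one_le hp h)).sum_le_tsum _ fun _ _ => by positivity

end FiniteSequences

/-! ### Weak norms in `C(K)` -/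

section WeakNorm

variable {E : Type*} [NormedAddCommGroup E] [NormedSpace ℂ E]

theorem bddAbove_range_weak {p : ℝ} (hp : 0 ≤ p) {n : ℕ} (x : Fin n → E) :
    BddAbove (Set.range fun y : Metric.closedBall (0 : StrongDual ℂ E) 1 =>
      ∑ k, ‖(y : StrongDual ℂ E) (x k)‖ ^ p) := by
  refine ⟨∑ k, ‖x k‖ ^ p, ?_⟩
  rintro _ ⟨y, rfl⟩
  dsimp only
  gcongr with k
  have hy : ‖(y : StrongDual ℂ E)‖ ≤ 1 := mem_closedBall_zero_iff.1 y.2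
  exact ((y : StrongDual ℂ E).le_of_opNorm_le hy _).trans_eq (one_mul _)

theorem norm_toLp_apply_le_weakNorm {p : ℝ≥0∞} (hp : 1 ≤ p) (hp' : p ≠ ∞) {n : ℕ}
    (x : Fin n → E) (y : StrongDual ℂ E) (hy : ‖y‖ ≤ 1) :
    ‖(WithLp.toLp p (fun k => y (x k)) : PiLp p fun _ => ℂ)‖ ≤ weakNorm p x := by
  rw [norm_toLp_eq_sum hp hp', weakNorm]
  gcongr
  exact le_ciSup (bddAbove_range_weak ENNReal.toReal_nonneg x) ⟨y, by simpa using hy⟩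

theorem weakNorm_nonneg (p : ℝ≥0∞) {n : ℕ} (x : Fin n → E) : 0 ≤ weakNorm p x :=
  Real.rpow_nonneg (Real.iSup_nonneg fun _ => by positivity) _

/-- The initial segments of a weakly `p`-summable sequence have bounded weak `ℓ_p`-norms: this is
the uniform boundedness principle for the operators `y ↦ (y (x_n))_{n < N}` from `E^*` to the
finite-dimensional `ℓ_p`-spaces. -/
theorem WeaklySummable.exists_bound {p : ℝ≥0∞} (hp : 1 ≤ p) (hp' : p ≠ ∞) {x : ℕ → E}
    (hx : WeaklySummable p x) :
    ∃ M : ℝ, 0 ≤ M ∧ ∀ (y : StrongDual ℂ E) (N : ℕ),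
      ‖(WithLp.toLp p (fun k : Fin N => y (x k)) : PiLp p fun _ => ℂ)‖ ≤ M * ‖y‖ := by
  have : Fact (1 ≤ p) := ⟨hp⟩
  let T : ∀ N : ℕ, StrongDual ℂ E →L[ℂ] PiLp p (fun _ : Fin N => ℂ) := fun N =>
    ((PiLp.continuousLinearEquiv p ℂ (fun _ : Fin N => ℂ)).symm : _ →L[ℂ] _) ∘L
      ContinuousLinearMap.pi fun k : Fin N => ContinuousLinearMap.apply ℂ ℂ (x k)
  have hT : ∀ N y, T N y = WithLp.toLp p (fun k : Fin N => y (x k)) := fun N y => rfl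
  -- The targets vary with `N`, so the principle is applied to the scalar-valued compositions
  -- with the functionals in the unit balls of their duals.
  let J := Σ N : ℕ, {φ : StrongDual ℂ (PiLp p (fun _ : Fin N => ℂ)) // ‖φ‖ ≤ 1}
  obtain ⟨C, hC⟩ := banach_steinhaus (g := fun j : J => (j.2.1 ∘L T j.1 : StrongDual ℂ E →L[ℂ] ℂ))
    (by
      intro y
      refine ⟨(∑' n, ‖y (x n)‖ ^ p.toReal) ^ (1 / p.toReal), fun j => ?_⟩
      calc ‖j.2.1 (T j.1 y)‖ ≤ 1 * ‖T j.1 y‖ := j.2.1.le_of_opNorm_le j.2.2 _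
        _ ≤ _ := by
          rw [one_mul, hT, norm_toLp_eq_sum hp hp']
          gcongr
          rw [Fin.sum_univ_eq_sum_range (fun n => ‖y (x n)‖ ^ p.toReal)]
          exact (hx y).sum_le_tsum _ fun _ _ => by positivity)
  refine ⟨max C 0, le_max_right _ _, fun y N => ?_⟩
  rw [← hT]
  refine NormedSpace.norm_le_dual_bound ℂ _ (by positivity) fun φ => ?_
  rcases eq_or_ne φ 0 with rfl | hφ
  · simp
  have hφ' : ‖φ‖ ≠ 0 := norm_ne_zero_iff.2 hφ
  have h1 : ‖((‖φ‖⁻¹ : ℝ) : ℂ) • φ‖ ≤ 1 := by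
    rw [norm_smul]; simp [hφ']
  have h2 := ContinuousLinearMap.le_of_opNorm_le _ (hC ⟨N, _, h1⟩) y
  simp only [ContinuousLinearMap.comp_apply, smul_apply, norm_smul,
    Complex.norm_real, norm_inv, norm_norm] at h2
  rw [inv_mul_le_iff₀ (by positivity)] at h2
  calc ‖φ (T N y)‖ ≤ ‖φ‖ * (C * ‖y‖) := h2
    _ ≤ ‖φ‖ * (max C 0 * ‖y‖) := by gcongr; exact le_max_left _ _
    _ = _ := mul_comm _ _

variable {K : Type*} [TopologicalSpace K] [CompactSpace K]

/-- Evaluation at a point, as an element of the dual of `C(K)`. -/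
noncomputable def evalDual (s : K) : StrongDual ℂ C(K, ℂ) :=
  LinearMap.mkContinuous
    { toFun := fun f => f s
      map_add' := fun _ _ => rfl
      map_smul' := fun _ _ => rfl } 1 fun f => by simpa using f.norm_coe_le_norm s

theorem norm_evalDual_le (s : K) : ‖evalDual s‖ ≤ 1 :=
  LinearMap.mkContinuous_norm_le _ zero_le_one _

end WeakNorm

/-! ### The duality map of the scalars -/

section DualityMap

/-- The scalar duality map `z ↦ |z|^{b-2} z̄`, i.e. the conjugate of the gradient of
`|z|^b / b`. At `z = 0` it vanishes because of the factor `z̄`, whatever the value of the power. -/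
noncomputable def dualityMap (b : ℝ) (z : ℂ) : ℂ := ((‖z‖ ^ (b - 2) : ℝ) : ℂ) * star z

variable {a b : ℝ}

theorem norm_dualityMap (hb : 1 < b) (z : ℂ) : ‖dualityMap b z‖ = ‖z‖ ^ (b - 1) := by
  rw [dualityMap, norm_mul, norm_star, Complex.norm_real, Real.norm_of_nonneg (by positivity)]
  rcases eq_or_ne z 0 with rfl | hz
  · rw [norm_zero, mul_zero, Real.zero_rpow (by linarith)]
  · rw [← Real.rpow_add_one (norm_ne_zero_iff.2 hz)]
    congr 1; ring

theorem dualityMap_mul_self (hb : 1 < b) (z : ℂ) : dualityMap b z * z = ((‖z‖ ^ b : ℝ) : ℂ) := by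
  rcases eq_or_ne z 0 with rfl | hz
  · rw [mul_zero, norm_zero, Real.zero_rpow (by linarith), Complex.ofReal_zero]
  · have h : star z * z = ((‖z‖ ^ (2 : ℕ) : ℝ) : ℂ) := by
      rw [mul_comm]; simpa using Complex.mul_conj' z
    rw [dualityMap, mul_assoc, h, ← Complex.ofReal_mul, ← Real.rpow_add_natCast
      (norm_ne_zero_iff.2 hz)]
    congr 2; push_cast; ring

theorem norm_dualityMap_rpow (hab : a.HolderConjugate b) (z : ℂ) :
    ‖dualityMap b z‖ ^ a = ‖z‖ ^ b := by
  rw [norm_dualityMap hab.symm.lt, ← Real.rpow_mul (norm_nonneg _)]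
  congr 1
  rw [mul_comm]
  have := hab.mul_eq_add
  linarith

theorem dualityMap_smul (b : ℝ) {t : ℝ} (ht : 0 < t) (z : ℂ) :
    dualityMap b (t * z) = ((t ^ (b - 1) : ℝ) : ℂ) * dualityMap b z := by
  have h : t ^ (b - 1) = t ^ (b - 2) * t := by
    rw [← Real.rpow_add_one ht.ne']; congr 1; ring
  rw [dualityMap, dualityMap, norm_mul, Complex.norm_real, Real.norm_of_nonneg ht.le,
    Real.mul_rpow ht.le (norm_nonneg _), h, star_mul']
  have : star (t : ℂ) = t := Complex.conj_ofReal t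
  rw [this]
  push_cast
  ring

theorem continuous_dualityMap (hb : 1 < b) : Continuous (dualityMap b) := by
  rw [continuous_iff_continuousAt]
  intro z
  rcases eq_or_ne z 0 with rfl | hz
  · have h0 : dualityMap b 0 = 0 := by simp [dualityMap]
    rw [ContinuousAt, h0, tendsto_zero_iff_norm_tendsto_zero]
    simp_rw [norm_dualityMap hb]
    have h1 : Continuous fun z : ℂ => ‖z‖ ^ (b - 1) :=
      continuous_norm.rpow_const fun _ => Or.inr (by linarith)
    simpa [Real.zero_rpow (by linarith : b - 1 ≠ 0)] using h1.tendsto 0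
  · have h1 : ContinuousAt (fun z : ℂ => ‖z‖ ^ (b - 2)) z :=
      continuous_norm.continuousAt.rpow_const (Or.inl (norm_ne_zero_iff.2 hz))
    exact (Complex.continuous_ofReal.continuousAt.comp h1).mul continuous_star.continuousAt

/-- Convexity of `|z|^b`: the graph lies above its tangents. -/
theorem rpow_norm_add_le (hab : a.HolderConjugate b) (z w : ℂ) :
    ‖z‖ ^ b + b * (dualityMap b z * w).re ≤ ‖z + w‖ ^ b := by
  have hb := hab.symm.lt
  have b0 : 0 < b := by linarith
  have h1 : (dualityMap b z * (z + w)).re ≤ ‖z‖ ^ b / a + ‖z + w‖ ^ b / b := by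
    refine (Complex.re_le_norm _).trans ?_
    rw [norm_mul, ← norm_dualityMap_rpow hab z]
    exact Real.young_inequality_of_nonneg (norm_nonneg _) (norm_nonneg _) hab
  rw [mul_add, Complex.add_re, dualityMap_mul_self hb, Complex.ofReal_re] at h1
  have h2 : b / a = b - 1 := by
    have ha := hab.pos.ne'
    have := hab.mul_eq_add
    field_simp
    linarith
  have h3 := mul_le_mul_of_nonneg_left h1 b0.le
  have h4 : b * (‖z‖ ^ b / a + ‖z + w‖ ^ b / b) = b / a * ‖z‖ ^ b + ‖z + w‖ ^ b := by
    field_simp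
  rw [h4, h2] at h3
  linarith

/-- Uniform continuity of the duality map, in the homogeneous form that integrates to uniform
continuity from `L_b` to `L_a` on bounded sets. It follows from compactness of the unit sphere of
`ℂ × ℂ`. -/
theorem exists_norm_dualityMap_sub_rpow_le (hab : a.HolderConjugate b) {ε : ℝ} (hε : 0 < ε) :
    ∃ C : ℝ, 0 ≤ C ∧ ∀ z w : ℂ, ‖dualityMap b z - dualityMap b w‖ ^ a ≤
      ε * (‖z‖ ^ b + ‖w‖ ^ b) + C * ‖z - w‖ ^ b := by
  have hb := hab.symm.lt
  have ha := hab.lt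
  have a0 := hab.pos
  have b0 := hab.symm.pos
  have hcont := continuous_dualityMap hb
  have hu : Continuous fun x : ℂ × ℂ => ‖dualityMap b x.1 - dualityMap b x.2‖ ^ a :=
    ((hcont.comp continuous_fst).sub (hcont.comp continuous_snd)).norm.rpow_const
      fun _ => Or.inr a0.le
  have hv : Continuous fun x : ℂ × ℂ => ‖x.1 - x.2‖ ^ b :=
    (continuous_fst.sub continuous_snd).norm.rpow_const fun _ => Or.inr b0.le
  set S := Metric.sphere (0 : ℂ × ℂ) 1 ∩
    {x | ε ≤ ‖dualityMap b x.1 - dualityMap b x.2‖ ^ a} with hS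
  have hSc : IsCompact S := (isCompact_sphere _ _).inter_right (isClosed_le continuous_const hu)
  have key : ∃ C : ℝ, 0 ≤ C ∧ ∀ x ∈ Metric.sphere (0 : ℂ × ℂ) 1,
      ‖dualityMap b x.1 - dualityMap b x.2‖ ^ a ≤ ε + C * ‖x.1 - x.2‖ ^ b := by
    rcases S.eq_empty_or_nonempty with hSe | hSn
    · refine ⟨0, le_rfl, fun x hx => ?_⟩
      by_contra hcon
      have : x ∈ S := ⟨hx, by simp only [Set.mem_ofPred_eq]; linarith⟩
      simp [hSe] at this
    · obtain ⟨x0, hx0, hmin⟩ := hSc.exists_isMinOn hSn hv.continuousOn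
      obtain ⟨x1, hx1, hmax⟩ := hSc.exists_isMaxOn hSn hu.continuousOn
      set δ := ‖x0.1 - x0.2‖ ^ b
      set m := ‖dualityMap b x1.1 - dualityMap b x1.2‖ ^ a
      have m0 : 0 ≤ m := by positivity
      have hδ : 0 < δ := by
        refine Real.rpow_pos_of_pos (norm_pos_iff.2 (sub_ne_zero.2 fun h => ?_)) _
        have h2 : ε ≤ ‖dualityMap b x0.1 - dualityMap b x0.2‖ ^ a := hx0.2
        rw [h, sub_self, norm_zero, Real.zero_rpow a0.ne'] at h2
        linarith
      refine ⟨m / δ, by positivity, fun x hx => ?_⟩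
      by_cases hxS : x ∈ S
      · have h1 : ‖dualityMap b x.1 - dualityMap b x.2‖ ^ a ≤ m := hmax hxS
        have h2 : δ ≤ ‖x.1 - x.2‖ ^ b := hmin hxS
        have h3 : m ≤ m / δ * ‖x.1 - x.2‖ ^ b := by
          rw [div_mul_eq_mul_div, le_div_iff₀ hδ]
          gcongr
        linarith
      · have h1 : ‖dualityMap b x.1 - dualityMap b x.2‖ ^ a < ε := by
          by_contra hcon
          exact hxS ⟨hx, not_lt.1 hcon⟩
        have : 0 ≤ m / δ * ‖x.1 - x.2‖ ^ b := by positivity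
        linarith
  obtain ⟨C, hC, hC'⟩ := key
  refine ⟨C, hC, fun z w => ?_⟩
  set t : ℝ := ‖(z, w)‖ with ht
  rcases eq_or_ne t 0 with h0 | h0
  · obtain ⟨rfl, rfl⟩ : z = 0 ∧ w = 0 := by
      simpa using norm_eq_zero.1 (ht ▸ h0 : ‖(z, w)‖ = 0)
    simp only [sub_self, norm_zero, Real.zero_rpow a0.ne', Real.zero_rpow b0.ne']
    simp
  have t0 : 0 < t := lt_of_le_of_ne (norm_nonneg _) (Ne.symm h0)
  set z' : ℂ := ((t⁻¹ : ℝ) : ℂ) * z with hz'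
  set w' : ℂ := ((t⁻¹ : ℝ) : ℂ) * w with hw'
  have hz : z = (t : ℂ) * z' := by
    rw [hz', ← mul_assoc, ← Complex.ofReal_mul, mul_inv_cancel₀ h0]; simp
  have hw : w = (t : ℂ) * w' := by
    rw [hw', ← mul_assoc, ← Complex.ofReal_mul, mul_inv_cancel₀ h0]; simp
  have hmem : (z', w') ∈ Metric.sphere (0 : ℂ × ℂ) 1 := by
    have : (z', w') = ((t⁻¹ : ℝ) : ℂ) • (z, w) := rfl
    rw [mem_sphere_zero_iff_norm, this, norm_smul, Complex.norm_real, ← ht,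
      Real.norm_of_nonneg (by positivity), inv_mul_cancel₀ h0]
  have h1 := hC' _ hmem
  have h2 : 1 ≤ ‖z'‖ ^ b + ‖w'‖ ^ b := by
    have h3 : max ‖z'‖ ‖w'‖ = 1 := by simpa [Prod.norm_def] using hmem
    rcases max_choice ‖z'‖ ‖w'‖ with h | h
    · rw [h] at h3
      rw [h3, Real.one_rpow]
      have : 0 ≤ ‖w'‖ ^ b := by positivity
      linarith
    · rw [h] at h3
      rw [h3, Real.one_rpow]
      have : 0 ≤ ‖z'‖ ^ b := by positivity
      linarith
  have hpow : (t ^ (b - 1)) ^ a = t ^ b := by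
    rw [← Real.rpow_mul t0.le]
    congr 1
    have := hab.mul_eq_add
    linarith
  have e1 : ‖dualityMap b z - dualityMap b w‖ ^ a =
      t ^ b * ‖dualityMap b z' - dualityMap b w'‖ ^ a := by
    rw [hz, hw, dualityMap_smul b t0, dualityMap_smul b t0, ← mul_sub, norm_mul,
      Complex.norm_real, Real.norm_of_nonneg (by positivity),
      Real.mul_rpow (by positivity) (norm_nonneg _), hpow]
  have e2 : ∀ v : ℂ, ‖(t : ℂ) * v‖ ^ b = t ^ b * ‖v‖ ^ b := fun v => by
    rw [norm_mul, Complex.norm_real, Real.norm_of_nonneg t0.le,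
      Real.mul_rpow t0.le (norm_nonneg _)]
  rw [e1, show z - w = (t : ℂ) * (z' - w') by rw [mul_sub, ← hz, ← hw], e2]
  rw [show ‖z‖ ^ b = t ^ b * ‖z'‖ ^ b by rw [← e2, ← hz],
    show ‖w‖ ^ b = t ^ b * ‖w'‖ ^ b by rw [← e2, ← hw]]
  have tb : 0 ≤ t ^ b := by positivity
  calc t ^ b * ‖dualityMap b z' - dualityMap b w'‖ ^ a
      ≤ t ^ b * (ε + C * ‖z' - w'‖ ^ b) := by gcongr
    _ ≤ t ^ b * (ε * (‖z'‖ ^ b + ‖w'‖ ^ b) + C * ‖z' - w'‖ ^ b) := by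
        gcongr; nlinarith
    _ = _ := by ring

end DualityMap

/-! ### Duality of `L_q` and `L_{q'}` over an arbitrary measure space -/

section LpDuality

variable {X : Type*} [MeasurableSpace X] {ν : Measure X}

theorem norm_Lp_rpow {r : ℝ≥0∞} [Fact (1 ≤ r)] (hr : r ≠ ∞) (f : Lp ℂ r ν) :
    ‖f‖ ^ r.toReal = ∫ x, ‖f x‖ ^ r.toReal ∂ν := by
  have h1 : (1 : ℝ≥0∞) ≤ r := Fact.out
  have h0 := toReal_pos_of_one_le h1 hr
  have hI : 0 ≤ ∫ x, ‖f x‖ ^ r.toReal ∂ν := integral_nonneg fun x => by positivity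
  rw [Lp.norm_def, (Lp.memLp f).eLpNorm_eq_integral_rpow_norm (zero_lt_one.trans_le h1).ne' hr,
    ENNReal.toReal_ofReal (by positivity), ← Real.rpow_mul hI, inv_mul_cancel₀ h0.ne',
    Real.rpow_one]

theorem integrable_norm_rpow_Lp {r : ℝ≥0∞} [Fact (1 ≤ r)] (hr : r ≠ ∞) (f : Lp ℂ r ν) :
    Integrable (fun x => ‖f x‖ ^ r.toReal) ν := by
  have h1 : (1 : ℝ≥0∞) ≤ r := Fact.out
  exact (integrable_norm_rpow_iff (Lp.memLp f).1 (zero_lt_one.trans_le h1).ne' hr).2 (Lp.memLp f)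

theorem integrable_Lp_mul {q r : ℝ≥0∞} [ENNReal.HolderConjugate q r] (g : Lp ℂ q ν)
    (y : Lp ℂ r ν) : Integrable (fun x => g x * y x) ν :=
  (Lp.memLp g).integrable_mul (Lp.memLp y)

variable {q r : ℝ≥0∞} [hq1 : Fact (1 ≤ q)] [hr1 : Fact (1 ≤ r)] [hqr : ENNReal.HolderConjugate q r]

variable (ν q r) in
/-- The bilinear pairing `⟨g, y⟩ = ∫ g y dν` of `L_q` and `L_r`, for conjugate `q` and `r`. -/
noncomputable def lqPairing : Lp ℂ q ν →L[ℂ] StrongDual ℂ (Lp ℂ r ν) :=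
  (ContinuousLinearMap.mul ℂ ℂ).lpPairing ν q r

theorem lqPairing_apply (g : Lp ℂ q ν) (y : Lp ℂ r ν) :
    lqPairing ν q r g y = ∫ x, g x * y x ∂ν := by
  rw [lqPairing, ContinuousLinearMap.lpPairing_eq_integral]
  rfl

theorem norm_lqPairing_apply_le (hq : q ≠ ∞) (hr : r ≠ ∞) (g : Lp ℂ q ν) (y : Lp ℂ r ν) :
    ‖lqPairing ν q r g y‖ ≤ ‖g‖ * ‖y‖ := by
  have hab := ENNReal.HolderConjugate.toReal_of_ne_top (p := q) (q := r) hq hr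
  rw [lqPairing_apply]
  refine (norm_integral_le_integral_norm _).trans ?_
  simp_rw [norm_mul]
  have h1 : MemLp g (ENNReal.ofReal q.toReal) ν := by
    rw [ENNReal.ofReal_toReal hq]; exact Lp.memLp g
  have h2 : MemLp y (ENNReal.ofReal r.toReal) ν := by
    rw [ENNReal.ofReal_toReal hr]; exact Lp.memLp y
  refine (integral_mul_norm_le_Lp_mul_Lq hab h1 h2).trans_eq ?_
  rw [← norm_Lp_rpow hq, ← norm_Lp_rpow hr, ← Real.rpow_mul (norm_nonneg _),
    ← Real.rpow_mul (norm_nonneg _), mul_one_div_cancel hab.pos.ne',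
    mul_one_div_cancel hab.symm.pos.ne', Real.rpow_one, Real.rpow_one]

theorem memLp_dualityMap (hq : q ≠ ∞) (hr : r ≠ ∞) (y : Lp ℂ r ν) :
    MemLp (fun x => dualityMap r.toReal (y x)) q ν := by
  have hab := ENNReal.HolderConjugate.toReal_of_ne_top (p := q) (q := r) hq hr
  have hm : AEStronglyMeasurable (fun x => dualityMap r.toReal (y x)) ν :=
    (continuous_dualityMap hab.symm.lt).comp_aestronglyMeasurable (Lp.memLp y).1
  rw [← integrable_norm_rpow_iff hm (zero_lt_one.trans_le hq1.out).ne' hq]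
  simp_rw [norm_dualityMap_rpow hab]
  exact integrable_norm_rpow_Lp hr y

/-- The duality map `L_r → L_q`, `y ↦ |y|^{r-2} ȳ`. -/
noncomputable def lpDualityMap (hq : q ≠ ∞) (hr : r ≠ ∞) (y : Lp ℂ r ν) : Lp ℂ q ν :=
  (memLp_dualityMap hq hr y).toLp _

theorem coeFn_lpDualityMap (hq : q ≠ ∞) (hr : r ≠ ∞) (y : Lp ℂ r ν) :
    lpDualityMap hq hr y =ᵐ[ν] fun x => dualityMap r.toReal (y x) :=
  MemLp.coeFn_toLp _

theorem norm_lpDualityMap_rpow (hq : q ≠ ∞) (hr : r ≠ ∞) (y : Lp ℂ r ν) :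
    ‖lpDualityMap hq hr y‖ ^ q.toReal = ‖y‖ ^ r.toReal := by
  have hab := ENNReal.HolderConjugate.toReal_of_ne_top (p := q) (q := r) hq hr
  rw [norm_Lp_rpow hq, norm_Lp_rpow hr]
  refine integral_congr_ae ?_
  filter_upwards [coeFn_lpDualityMap hq hr y] with x hx
  rw [hx, norm_dualityMap_rpow hab]

theorem norm_lqPairing (hq : q ≠ ∞) (hr : r ≠ ∞) (g : Lp ℂ q ν) : ‖lqPairing ν q r g‖ = ‖g‖ := by
  have hab := ENNReal.HolderConjugate.toReal_of_ne_top (p := q) (q := r) hq hr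
  have : ENNReal.HolderConjugate r q := hqr.symm
  refine le_antisymm (ContinuousLinearMap.opNorm_le_bound _ (norm_nonneg _)
    fun y => norm_lqPairing_apply_le hq hr g y) ?_
  rcases eq_or_ne g 0 with rfl | hg
  · simp
  have g0 : 0 < ‖g‖ := norm_pos_iff.2 hg
  -- The functional is tested on the image of `g` under the duality map in the other direction.
  set y : Lp ℂ r ν := lpDualityMap hr hq g with hy
  have h1 : lqPairing ν q r g y = ((‖g‖ ^ q.toReal : ℝ) : ℂ) := by
    rw [lqPairing_apply, norm_Lp_rpow hq, ← integral_complex_ofReal]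
    refine integral_congr_ae ?_
    filter_upwards [coeFn_lpDualityMap hr hq g] with x hx
    rw [hx, mul_comm, dualityMap_mul_self hab.lt]
  have h2 : ‖y‖ = ‖g‖ ^ (q.toReal - 1) := by
    rw [← Real.rpow_left_inj (norm_nonneg _) (by positivity) hab.symm.pos.ne', hy,
      norm_lpDualityMap_rpow, ← Real.rpow_mul g0.le]
    congr 1
    have := hab.mul_eq_add
    linarith
  have h3 := (lqPairing ν q r g).le_opNorm y
  rw [h1, h2, Complex.norm_real, Real.norm_of_nonneg (by positivity)] at h3
  have h4 : ‖g‖ ^ q.toReal = ‖g‖ * ‖g‖ ^ (q.toReal - 1) := by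
    rw [← Real.rpow_one_add' g0.le (by linarith [hab.pos])]
    congr 1; ring
  rw [h4] at h3
  exact le_of_mul_le_mul_right h3 (by positivity)

/-- Integrated convexity of `|·|^r`. -/
theorem norm_add_rpow_le (hq : q ≠ ∞) (hr : r ≠ ∞) (y h : Lp ℂ r ν) :
    ‖y + h‖ ^ r.toReal ≤
      ‖y‖ ^ r.toReal + r.toReal * (lqPairing ν q r (lpDualityMap hq hr (y + h)) h).re := by
  have hab := ENNReal.HolderConjugate.toReal_of_ne_top (p := q) (q := r) hq hr
  rw [norm_Lp_rpow hr, norm_Lp_rpow hr, lqPairing_apply]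
  have hi := integrable_Lp_mul (lpDualityMap hq hr (y + h)) h
  have e : (∫ x, lpDualityMap hq hr (y + h) x * h x ∂ν).re =
      ∫ x, (lpDualityMap hq hr (y + h) x * h x).re ∂ν := (integral_re hi).symm
  have hre : Integrable (fun x => r.toReal * (lpDualityMap hq hr (y + h) x * h x).re) ν :=
    hi.re.const_mul _
  rw [e, ← integral_const_mul, ← integral_add (integrable_norm_rpow_Lp hr _) hre]
  refine integral_mono_ae (integrable_norm_rpow_Lp hr _)
    ((integrable_norm_rpow_Lp hr _).add hre) ?_
  filter_upwards [coeFn_lpDualityMap hq hr (y + h), Lp.coeFn_add y h] with x h1 h2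
  have h3 := rpow_norm_add_le hab ((y + h : Lp ℂ r ν) x) (-h x)
  rw [h1]
  have h4 : (y + h : Lp ℂ r ν) x + -h x = y x := by rw [h2]; simp
  rw [h4, mul_neg, Complex.neg_re] at h3
  linarith

/-- Uniform continuity of the duality map on bounded sets. -/
theorem norm_lpDualityMap_sub_rpow_le (hq : q ≠ ∞) (hr : r ≠ ∞) {ε C : ℝ}
    (h : ∀ z w : ℂ, ‖dualityMap r.toReal z - dualityMap r.toReal w‖ ^ q.toReal ≤
      ε * (‖z‖ ^ r.toReal + ‖w‖ ^ r.toReal) + C * ‖z - w‖ ^ r.toReal) (y y' : Lp ℂ r ν) :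
    ‖lpDualityMap hq hr y - lpDualityMap hq hr y'‖ ^ q.toReal ≤
      ε * (‖y‖ ^ r.toReal + ‖y'‖ ^ r.toReal) + C * ‖y - y'‖ ^ r.toReal := by
  rw [norm_Lp_rpow hq, norm_Lp_rpow hr, norm_Lp_rpow hr, norm_Lp_rpow hr]
  have i1 := integrable_norm_rpow_Lp hr y
  have i2 := integrable_norm_rpow_Lp hr y'
  have i3 := integrable_norm_rpow_Lp hr (y - y')
  have i4 : Integrable (fun x => ε * (‖y x‖ ^ r.toReal + ‖y' x‖ ^ r.toReal)) ν :=
    (i1.add i2).const_mul _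
  rw [← integral_add i1 i2, ← integral_const_mul, ← integral_const_mul,
    ← integral_add i4 (i3.const_mul _)]
  refine integral_mono_ae (integrable_norm_rpow_Lp hq _)
    (i4.add (i3.const_mul _)) ?_
  filter_upwards [coeFn_lpDualityMap hq hr y, coeFn_lpDualityMap hq hr y',
    Lp.coeFn_sub y y', Lp.coeFn_sub (lpDualityMap hq hr y) (lpDualityMap hq hr y')]
    with x h1 h2 h3 h4
  rw [h4, h3]
  simp only [Pi.sub_apply]
  rw [h1, h2]
  exact h _ _

/-- A functional of norm one on `L_r` is approximated by the images under the duality map of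
vectors at which it almost attains its norm. -/
theorem exists_norm_sub_lqPairing_le (hq : q ≠ ∞) (hr : r ≠ ∞) (ψ : StrongDual ℂ (Lp ℂ r ν))
    (hψ : ‖ψ‖ = 1) {ε : ℝ} (hε : 0 < ε) : ∃ g : Lp ℂ q ν, ‖ψ - lqPairing ν q r g‖ ≤ ε := by
  have hab := ENNReal.HolderConjugate.toReal_of_ne_top (p := q) (q := r) hq hr
  set a := q.toReal
  set b := r.toReal with hb
  have a0 := hab.pos
  have b0 := hab.symm.pos
  have b1 := hab.symm.lt
  set η : ℝ := (ε / 2) ^ a / 2 with hη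
  have η0 : 0 < η := by positivity
  obtain ⟨C, hC, hC'⟩ := exists_norm_dualityMap_sub_rpow_le hab
    (ε := η / (2 ^ b + 1)) (by positivity)
  -- The step `s` makes the displacement of the duality map small.
  obtain ⟨s, s0, s1, hs⟩ : ∃ s : ℝ, 0 < s ∧ s ≤ 1 ∧ C * s ^ b ≤ η := by
    have h1 : Continuous fun s : ℝ => C * s ^ b :=
      continuous_const.mul (Real.continuous_rpow_const b0.le)
    have h2 := h1.tendsto 0
    rw [Real.zero_rpow b0.ne', mul_zero] at h2
    have h3 : ∀ᶠ s in 𝓝[>] (0 : ℝ), C * s ^ b < η :=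
      (h2.mono_left nhdsWithin_le_nhds).eventually_lt_const η0
    have h4 : ∀ᶠ s in 𝓝[>] (0 : ℝ), s ∈ Set.Ioc (0 : ℝ) 1 :=
      Ioc_mem_nhdsGT zero_lt_one
    obtain ⟨s, hs, hs'⟩ := (h3.and h4).exists
    exact ⟨s, hs'.1, hs'.2, hs.le⟩
  set δ := s * (ε / 2) with hδ
  have δ0 : 0 < δ := by positivity
  obtain ⟨y, hy1, hy⟩ : ∃ y : Lp ℂ r ν, ‖y‖ ≤ 1 ∧ 1 - δ ≤ (ψ y).re := by
    obtain ⟨y, hy, hy'⟩ := ψ.exists_lt_apply_of_lt_opNorm (r := 1 - δ) (by rw [hψ]; linarith)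
    obtain ⟨c, hc, hc'⟩ := RCLike.exists_norm_eq_mul_self (ψ y)
    refine ⟨c • y, by rw [norm_smul, hc, one_mul]; exact hy.le, ?_⟩
    rw [map_smul, smul_eq_mul, ← hc']
    exact hy'.le
  have hyb : ‖y‖ ^ b ≤ 1 := Real.rpow_le_one (norm_nonneg _) hy1 b0.le
  refine ⟨lpDualityMap hq hr y, ?_⟩
  have key : ∀ h : Lp ℂ r ν, ‖h‖ = 1 →
      ((ψ - lqPairing ν q r (lpDualityMap hq hr y)) h).re ≤ ε := by
    intro h hh
    set w : Lp ℂ r ν := (s : ℂ) • h with hw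
    have hwn : ‖w‖ = s := by
      rw [hw, norm_smul, hh, mul_one, Complex.norm_real, Real.norm_of_nonneg s0.le]
    have e1 : (ψ (y + w)).re = (ψ y).re + s * (ψ h).re := by
      rw [map_add, hw, map_smul, smul_eq_mul, Complex.add_re, Complex.re_ofReal_mul]
    have e2 : (ψ (y + w)).re ≤ ‖y + w‖ := by
      refine (Complex.re_le_norm _).trans ((ψ.le_opNorm _).trans_eq ?_)
      rw [hψ, one_mul]
    have e3 := norm_add_rpow_le hq hr y w
    have e4 : (lqPairing ν q r (lpDualityMap hq hr (y + w)) w).re =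
        s * (lqPairing ν q r (lpDualityMap hq hr (y + w)) h).re := by
      rw [hw, map_smul, smul_eq_mul, Complex.re_ofReal_mul]
    have e5 : 1 + b * (‖y + w‖ - 1) ≤ ‖y + w‖ ^ b := by
      have := one_add_mul_self_le_rpow_one_add (s := ‖y + w‖ - 1)
        (by linarith [norm_nonneg (y + w)]) b1.le
      simpa using this
    set R := (lqPairing ν q r (lpDualityMap hq hr (y + w)) h).re with hR
    have e6 : ‖y + w‖ - 1 ≤ s * R := by
      rw [e4] at e3
      have : b * (‖y + w‖ - 1) ≤ b * (s * R) := by linarith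
      exact le_of_mul_le_mul_left this b0
    have e7 : (ψ h).re ≤ ε / 2 + R := by
      have : s * (ψ h).re ≤ s * (ε / 2 + R) := by linarith
      exact le_of_mul_le_mul_left this s0
    have e8 : ‖lpDualityMap hq hr (y + w) - lpDualityMap hq hr y‖ ≤ ε / 2 := by
      rw [← Real.rpow_le_rpow_iff (norm_nonneg _) (by positivity) a0]
      refine (norm_lpDualityMap_sub_rpow_le hq hr hC' (y + w) y).trans ?_
      have e9 : ‖y + w‖ ^ b ≤ 2 ^ b := by
        gcongr
        exact (norm_add_le _ _).trans (by linarith)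
      rw [add_sub_cancel_left, hwn]
      have e10 : η / (2 ^ b + 1) * (‖y + w‖ ^ b + ‖y‖ ^ b) ≤ η := by
        rw [div_mul_eq_mul_div, div_le_iff₀ (by positivity)]
        gcongr
      have : (ε / 2) ^ a = 2 * η := by rw [hη]; ring
      rw [this]
      linarith
    have e11 : R - (lqPairing ν q r (lpDualityMap hq hr y) h).re ≤ ε / 2 := by
      rw [hR, ← Complex.sub_re, ← sub_apply, ← map_sub]
      refine (Complex.re_le_norm _).trans ((norm_lqPairing_apply_le hq hr _ _).trans ?_)
      rw [hh, mul_one]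
      exact e8
    rw [sub_apply, Complex.sub_re]
    linarith
  refine ContinuousLinearMap.opNorm_le_of_unit_norm hε.le fun h hh => ?_
  obtain ⟨c, hc, hc'⟩ := RCLike.exists_norm_eq_mul_self
    ((ψ - lqPairing ν q r (lpDualityMap hq hr y)) h)
  have h1 := key (c • h) (by rw [norm_smul, hc, one_mul, hh])
  rw [map_smul, smul_eq_mul, ← hc'] at h1
  exact h1

/-- `L_q` is the dual of `L_r`: the pairing is isometric, so that its range is closed, and the range
is dense because of the approximation by the duality map. -/
theorem surjective_lqPairing (hq : q ≠ ∞) (hr : r ≠ ∞) :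
    Function.Surjective (lqPairing ν q r) := by
  have hiso : Isometry (lqPairing ν q r) :=
    AddMonoidHomClass.isometry_of_norm _ (norm_lqPairing hq hr)
  have hcl : IsClosed (Set.range (lqPairing ν q r)) :=
    hiso.antilipschitz.isClosed_range hiso.uniformContinuous
  intro ψ
  rcases eq_or_ne ψ 0 with rfl | hψ
  · exact ⟨0, map_zero _⟩
  have hψ0 : ‖ψ‖ ≠ 0 := norm_ne_zero_iff.2 hψ
  set ψ' : StrongDual ℂ (Lp ℂ r ν) := ((‖ψ‖⁻¹ : ℝ) : ℂ) • ψ with hψ'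
  have h1 : ‖ψ'‖ = 1 := by
    rw [hψ', norm_smul, Complex.norm_real, norm_inv, norm_norm, inv_mul_cancel₀ hψ0]
  have h2 : ψ' ∈ Set.range (lqPairing ν q r) := by
    rw [← hcl.closure_eq, Metric.mem_closure_range_iff]
    intro ε hε
    obtain ⟨g, hg⟩ := exists_norm_sub_lqPairing_le hq hr ψ' h1 (half_pos hε)
    exact ⟨g, by rw [dist_eq_norm]; linarith⟩
  obtain ⟨g, hg⟩ := h2
  refine ⟨(‖ψ‖ : ℂ) • g, ?_⟩
  rw [map_smul, hg, hψ', smul_smul, ← Complex.ofReal_mul, mul_inv_cancel₀ hψ0, Complex.ofReal_one,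
    one_smul]

end LpDuality

/-! ### Positive operators on `C(K)` -/

section PositiveOperators

theorem norm_toLp_le_of_re_sum_le {q q' : ℝ≥0∞} [ENNReal.HolderConjugate q q'] (hq : q ≠ ∞) {n : ℕ}
    (a : Fin n → ℂ) {D : ℝ} (hD : 0 ≤ D)
    (h : ∀ c : Fin n → ℂ, (∑ k, c k * a k).re ≤
      ‖(WithLp.toLp q' c : PiLp q' fun _ => ℂ)‖ * D) :
    ‖(WithLp.toLp q a : PiLp q fun _ => ℂ)‖ ≤ D := by
  have : ENNReal.HolderConjugate q' q := ENNReal.HolderConjugate.symm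
  refine norm_toLp_le_of_forall (q' := q') hq a hD fun c hc => ?_
  choose u hu hu' using fun k => RCLike.exists_norm_eq_mul_self (a k)
  have h1 := h fun k => (c k : ℂ) * u k
  have h2 : ∑ k, (c k : ℂ) * u k * a k = ((∑ k, c k * ‖a k‖ : ℝ) : ℂ) := by
    push_cast
    refine Finset.sum_congr rfl fun k _ => ?_
    rw [mul_assoc, ← hu' k]
    rfl
  rw [h2, Complex.ofReal_re, mul_comm] at h1
  refine h1.trans (mul_le_mul_of_nonneg_left ?_ hD)
  refine norm_toLp_mono (ENNReal.HolderConjugate.one_le q' q) fun k => ?_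
  rw [norm_mul, hu k, mul_one, Complex.norm_real]

variable {K : Type*} [TopologicalSpace K] [CompactSpace K]
  {X : Type*} [MeasurableSpace X] {ν : Measure X} {q : ℝ≥0∞} [hq1 : Fact (1 ≤ q)]
  {T : C(K, ℂ) →L[ℂ] Lp ℂ q ν}

theorem IsPositiveOp.one_nonneg (hT : IsPositiveOp T) : ∀ᵐ x ∂ν, 0 ≤ (T 1 : X → ℂ) x :=
  hT 1 fun _ => by simp

theorem IsPositiveOp.re_le (hT : IsPositiveOp T) {f : C(K, ℂ)} {M : ℝ}
    (hreal : ∀ s, (f s).im = 0) (hM : ∀ s, (f s).re ≤ M) :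
    ∀ᵐ x ∂ν, (T f x).im = 0 ∧ (T f x).re ≤ M * (T 1 x).re := by
  have h1 := hT ((M : ℂ) • 1 - f) fun s => by
    rw [Complex.nonneg_iff]
    simp [hM s, hreal s]
  filter_upwards [h1, hT.one_nonneg, Lp.coeFn_sub (T ((M : ℂ) • 1)) (T f),
    Lp.coeFn_smul (M : ℂ) (T 1)] with x h1 h2 h3 h4
  rw [map_sub, h3, Pi.sub_apply, map_smul, h4] at h1
  simp only [Pi.smul_apply, smul_eq_mul, Complex.nonneg_iff, Complex.sub_re, Complex.sub_im,
    Complex.re_ofReal_mul, Complex.im_ofReal_mul] at h1 h2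
  refine ⟨?_, by linarith⟩
  rw [← h2.2, mul_zero] at h1
  linarith

/-- A positive operator commutes with taking real parts, so it preserves upper bounds of these. -/
theorem IsPositiveOp.re_le_of_re_le (hT : IsPositiveOp T) {f : C(K, ℂ)} {M : ℝ}
    (hM : ∀ s, (f s).re ≤ M) : ∀ᵐ x ∂ν, (T f x).re ≤ M * (T 1 x).re := by
  let u : C(K, ℂ) := ⟨fun s => ((f s).re : ℂ), by fun_prop⟩
  let v : C(K, ℂ) := ⟨fun s => ((f s).im : ℂ), by fun_prop⟩
  have hf : f = u + Complex.I • v := by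
    ext s
    simp only [ContinuousMap.add_apply, ContinuousMap.smul_apply, smul_eq_mul]
    exact (Complex.re_add_im (f s)).symm.trans (by rw [mul_comm]; rfl)
  have h1 := hT.re_le (f := u) (M := M) (fun s => Complex.ofReal_im _) fun s => by
    exact (Complex.ofReal_re _).le.trans (hM s)
  have h2 := hT.re_le (f := v) (M := ‖f‖) (fun s => Complex.ofReal_im _) fun s =>
    (Complex.ofReal_re _).le.trans ((Complex.im_le_norm _).trans (f.norm_coe_le_norm s))
  filter_upwards [h1, h2, Lp.coeFn_add (T u) (T (Complex.I • v)),
    Lp.coeFn_smul Complex.I (T v)] with x h1 h2 h3 h4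
  rw [hf, map_add, h3, Pi.add_apply, map_smul, h4]
  simp only [Pi.smul_apply, smul_eq_mul, Complex.add_re, Complex.mul_re, Complex.I_re,
    Complex.I_im, zero_mul, one_mul, zero_sub, h2.1, neg_zero, add_zero]
  exact h1.2

/-- A positive operator `T` satisfies the lattice inequality
`(∑ |T f_k|^q)^{1/q} ≤ M · T 1` whenever `(∑ |f_k|^q)^{1/q} ≤ M`: it suffices to test against a
countable dense set of coefficients. -/
theorem IsPositiveOp.norm_toLp_le (hT : IsPositiveOp T) (q' : ℝ≥0∞)
    [ENNReal.HolderConjugate q q'] (hq : q ≠ ∞) {n : ℕ} (f : Fin n → C(K, ℂ)) {M : ℝ} (hM : 0 ≤ M)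
    (hf : ∀ s, ‖(WithLp.toLp q (fun k => f k s) : PiLp q fun _ => ℂ)‖ ≤ M) :
    ∀ᵐ x ∂ν, ‖(WithLp.toLp q (fun k => T (f k) x) : PiLp q fun _ => ℂ)‖ ≤ M * (T 1 x).re := by
  have : ENNReal.HolderConjugate q' q := ENNReal.HolderConjugate.symm
  have hq' : Fact (1 ≤ q') := ⟨ENNReal.HolderConjugate.one_le q' q⟩
  have h1 : ∀ c : Fin n → ℂ, ∀ᵐ x ∂ν, (∑ k, c k * T (f k) x).re ≤
      ‖(WithLp.toLp q' c : PiLp q' fun _ => ℂ)‖ * (M * (T 1 x).re) := by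
    intro c
    have h2 := hT.re_le_of_re_le (f := ∑ k, c k • f k)
      (M := ‖(WithLp.toLp q' c : PiLp q' fun _ => ℂ)‖ * M) fun s => by
        refine (Complex.re_le_norm _).trans ?_
        rw [ContinuousMap.sum_apply]
        refine (norm_sum_le _ _).trans ?_
        simp only [ContinuousMap.smul_apply, norm_smul]
        have := sum_norm_mul_norm_le (q := q) (q' := q') hq (fun k => f k s) c
        calc ∑ k, ‖c k‖ * ‖f k s‖ = ∑ k, ‖f k s‖ * ‖c k‖ :=
              Finset.sum_congr rfl fun _ _ => mul_comm _ _
          _ ≤ _ := this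
          _ ≤ M * ‖(WithLp.toLp q' c : PiLp q' fun _ => ℂ)‖ := by gcongr; exact hf s
          _ = _ := mul_comm _ _
    have h3 : ∀ᵐ x ∂ν, ∀ k, (c k • T (f k) : Lp ℂ q ν) x = c k * T (f k) x :=
      ae_all_iff.2 fun k => Lp.coeFn_smul (c k) (T (f k))
    filter_upwards [h2, h3, Lp.coeFn_finsetSum Finset.univ fun k => c k • T (f k)]
      with x h2 h3 h4
    rw [map_sum] at h2
    simp only [map_smul] at h2
    rw [h4, Finset.sum_apply] at h2
    simp only [h3] at h2
    linarith
  have h5 : ∀ᵐ x ∂ν, ∀ i : ℕ,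
      (∑ k, TopologicalSpace.denseSeq (Fin n → ℂ) i k * T (f k) x).re ≤
      ‖(WithLp.toLp q' (TopologicalSpace.denseSeq (Fin n → ℂ) i) : PiLp q' fun _ => ℂ)‖ *
        (M * (T 1 x).re) := ae_all_iff.2 fun i => h1 _
  filter_upwards [h5, hT.one_nonneg] with x hx h0
  have h0' : 0 ≤ (T 1 x).re := (Complex.nonneg_iff.1 h0).1
  refine norm_toLp_le_of_re_sum_le (q' := q') hq _ (by positivity) fun c => ?_
  have hcl : IsClosed {c : Fin n → ℂ | (∑ k, c k * T (f k) x).re ≤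
      ‖(WithLp.toLp q' c : PiLp q' fun _ => ℂ)‖ * (M * (T 1 x).re)} := by
    refine isClosed_le (by fun_prop) ?_
    exact (PiLp.continuous_toLp q' (fun _ : Fin n => ℂ)).norm.mul continuous_const
  exact (TopologicalSpace.denseRange_denseSeq (Fin n → ℂ)).induction_on c hcl hx

end PositiveOperators

/-! ### Positive elements of the predual -/

section Predual

variable {X : Type*} [MeasurableSpace X] {ν : Measure X} {q : ℝ≥0∞}
  {F : Type*} [NormedAddCommGroup F] [NormedSpace ℂ F]

/-- The modulus `|g|` of an element of `L_q`. -/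
noncomputable def absLp (g : Lp ℂ q ν) : Lp ℂ q ν :=
  ((Lp.memLp g).norm.ofReal (K := ℂ)).toLp _

/-- The real part of an element of `L_q`. -/
noncomputable def reLp (g : Lp ℂ q ν) : Lp ℂ q ν :=
  ((Lp.memLp g).re.ofReal (K := ℂ)).toLp _

theorem coeFn_absLp (g : Lp ℂ q ν) : absLp g =ᵐ[ν] fun x => ((‖g x‖ : ℝ) : ℂ) :=
  MemLp.coeFn_toLp _

theorem coeFn_reLp (g : Lp ℂ q ν) : reLp g =ᵐ[ν] fun x => (((g x).re : ℝ) : ℂ) :=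
  MemLp.coeFn_toLp _

theorem absLp_nonneg (g : Lp ℂ q ν) : ∀ᵐ x ∂ν, 0 ≤ (absLp g : X → ℂ) x := by
  filter_upwards [coeFn_absLp g] with x hx
  rw [hx]
  exact Complex.zero_le_real.2 (norm_nonneg _)

theorem norm_absLp (g : Lp ℂ q ν) : ‖absLp g‖ = ‖g‖ := by
  refine le_antisymm (Lp.norm_le_norm_of_ae_le ?_) (Lp.norm_le_norm_of_ae_le ?_) <;>
  · filter_upwards [coeFn_absLp g] with x hx
    simp [hx]

variable [Fact (1 ≤ q)]

/-- Positivity of an element `z` of the predual `F`, as a functional on `L_q`. -/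
def IsPosPredual (Φ : Lp ℂ q ν →L[ℂ] StrongDual ℂ F) (z : F) : Prop :=
  ∀ g : Lp ℂ q ν, (∀ᵐ x ∂ν, 0 ≤ (g : X → ℂ) x) → 0 ≤ Φ g z

variable {Φ : Lp ℂ q ν →L[ℂ] StrongDual ℂ F} {z : F}

theorem IsPosPredual.mono (hz : IsPosPredual Φ z) {g h : Lp ℂ q ν}
    (hgh : ∀ᵐ x ∂ν, g x ≤ h x) : Φ g z ≤ Φ h z := by
  have h1 := hz (h - g) (by
    filter_upwards [hgh, Lp.coeFn_sub h g] with x h1 h2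
    rw [h2]
    exact sub_nonneg.2 h1)
  rw [map_sub, sub_apply] at h1
  exact sub_nonneg.1 h1

theorem IsPosPredual.im_eq_zero (hz : IsPosPredual Φ z) {g : Lp ℂ q ν}
    (hg : ∀ᵐ x ∂ν, (g x).im = 0) : (Φ g z).im = 0 := by
  have h1 : Φ g z ≤ Φ (absLp g) z := hz.mono (by
    filter_upwards [hg, coeFn_absLp g] with x h1 h2
    rw [h2, Complex.le_def]
    exact ⟨by simpa using Complex.re_le_norm _, by simpa using h1⟩)
  have h2 := hz _ (absLp_nonneg g)
  rw [(Complex.le_def.1 h1).2, ← (Complex.le_def.1 h2).2, Complex.zero_im]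

/-- A positive element only sees the real part of `g` in its real part. -/
theorem IsPosPredual.re_reLp (hz : IsPosPredual Φ z) (g : Lp ℂ q ν) :
    (Φ (reLp g) z).re = (Φ g z).re := by
  have h1 : ((Φ (Complex.I • (g - reLp g))) z).im = 0 := hz.im_eq_zero (by
    filter_upwards [coeFn_reLp g, Lp.coeFn_sub g (reLp g),
      Lp.coeFn_smul Complex.I (g - reLp g)] with x h1 h2 h3
    rw [h3, Pi.smul_apply, h2, Pi.sub_apply, h1]
    simp)
  rw [map_smul, map_sub] at h1
  simp only [smul_apply, sub_apply, smul_eq_mul, Complex.mul_im, Complex.I_re, Complex.I_im,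
    zero_mul, one_mul, zero_add, Complex.sub_re] at h1
  linarith

theorem IsPosPredual.norm_le (hz : IsPosPredual Φ z) (g : Lp ℂ q ν) :
    ‖Φ g z‖ ≤ (Φ (absLp g) z).re := by
  obtain ⟨c, hc, hc'⟩ := RCLike.exists_norm_eq_mul_self (Φ g z)
  have h1 : (Φ (reLp (c • g)) z).re = ‖Φ g z‖ := by
    rw [hz.re_reLp, map_smul, smul_apply, smul_eq_mul, ← hc']
    exact Complex.ofReal_re _
  rw [← h1]
  refine (Complex.le_def.1 (hz.mono ?_)).1
  filter_upwards [coeFn_reLp (c • g), coeFn_absLp g, Lp.coeFn_smul c g] with x h1 h2 h3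
  rw [h1, h2, h3, Complex.real_le_real, Pi.smul_apply, smul_eq_mul]
  refine (Complex.re_le_norm _).trans ?_
  rw [norm_mul, hc, one_mul]

theorem IsPosPredual.add {w : F} (hz : IsPosPredual Φ z) (hw : IsPosPredual Φ w) :
    IsPosPredual Φ (z + w) := fun g hg => by
  rw [map_add]; exact add_nonneg (hz g hg) (hw g hg)

end Predual

/-! ### Finite suprema in a predual of `L_1` -/

section PredualL1

variable {X : Type*} [MeasurableSpace X] {ν : Measure X}
  {F : Type*} [NormedAddCommGroup F] [NormedSpace ℂ F]
  {Φ : Lp ℂ 1 ν →L[ℂ] StrongDual ℂ F} {z : F}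

/-- The assumption on `F` in the case `q = 1`: it contains the moduli of its elements. -/
def HasModulus (Φ : Lp ℂ 1 ν →L[ℂ] StrongDual ℂ F) : Prop :=
  ∀ y : F, ∃ z : F, ∀ g : Lp ℂ 1 ν, (∀ᵐ x ∂ν, 0 ≤ (g : X → ℂ) x) →
      ∃ r : ℝ, Φ g z = (r : ℂ) ∧
        IsLUB {s : ℝ | ∃ h : Lp ℂ 1 ν,
          (∀ᵐ x ∂ν, ‖(h : X → ℂ) x‖ ≤ ‖(g : X → ℂ) x‖) ∧ s = ‖Φ h y‖} r

theorem HasModulus.exists_abs (hmod : HasModulus Φ) (y : F) : ∃ z : F, IsPosPredual Φ z ∧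
    (∀ h, ‖Φ h y‖ ≤ (Φ (absLp h) z).re) ∧
    ∀ g : Lp ℂ 1 ν, (∀ᵐ x ∂ν, 0 ≤ (g : X → ℂ) x) → ∀ B : ℝ,
      (∀ h : Lp ℂ 1 ν, (∀ᵐ x ∂ν, ‖h x‖ ≤ ‖g x‖) → ‖Φ h y‖ ≤ B) → (Φ g z).re ≤ B := by
  obtain ⟨z, hz⟩ := hmod y
  refine ⟨z, fun g hg => ?_, fun h => ?_, fun g hg B hB => ?_⟩
  · obtain ⟨r, hr, hr'⟩ := hz g hg
    rw [hr, Complex.zero_le_real]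
    exact (norm_nonneg _).trans (hr'.1 ⟨g, ae_of_all _ fun _ => le_rfl, rfl⟩)
  · obtain ⟨r, hr, hr'⟩ := hz _ (absLp_nonneg h)
    rw [hr, Complex.ofReal_re]
    refine hr'.1 ⟨h, ?_, rfl⟩
    filter_upwards [coeFn_absLp h] with x hx
    simp [hx]
  · obtain ⟨r, hr, hr'⟩ := hz g hg
    rw [hr, Complex.ofReal_re]
    refine hr'.2 ?_
    rintro _ ⟨h, hh, rfl⟩
    exact hB h hh

theorem IsPosPredual.norm_le_of_forall (hz : IsPosPredual Φ z)
    (hiso : ∀ g, ‖Φ g‖ = ‖g‖) (hsurj : Function.Surjective Φ) {R : ℝ} (hR : 0 ≤ R)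
    (h : ∀ g : Lp ℂ 1 ν, (∀ᵐ x ∂ν, 0 ≤ (g : X → ℂ) x) → (Φ g z).re ≤ R * ‖g‖) : ‖z‖ ≤ R := by
  refine NormedSpace.norm_le_dual_bound ℂ z hR fun ψ => ?_
  obtain ⟨g, rfl⟩ := hsurj ψ
  rw [hiso, ← norm_absLp]
  exact (hz.norm_le g).trans (h _ (absLp_nonneg g))

/-- Additivity of the norm of `L_1` on the positive cone. -/
theorem norm_add_add_norm_sub {g k : Lp ℂ 1 ν} (hk : ∀ᵐ x ∂ν, (k x).im = 0)
    (hg : ∀ᵐ x ∂ν, 0 ≤ (g : X → ℂ) x) (hkg : ∀ᵐ x ∂ν, |(k x).re| ≤ (g x).re) :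
    ‖g + k‖ + ‖g - k‖ = 2 * ‖g‖ := by
  rw [L1.norm_eq_integral_norm, L1.norm_eq_integral_norm, L1.norm_eq_integral_norm,
    ← integral_const_mul, ← integral_add (L1.integrable_coeFn _).norm (L1.integrable_coeFn _).norm]
  refine integral_congr_ae ?_
  filter_upwards [hk, hg, hkg, Lp.coeFn_add g k, Lp.coeFn_sub g k] with x h1 h2 h3 h4 h5
  have h6 : ∀ w : ℂ, 0 ≤ w.re → w.im = 0 → ‖w‖ = w.re := fun w hw hw' => by
    rw [← abs_of_nonneg hw]; exact (Complex.abs_re_eq_norm.2 hw').symm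
  have h7 := Complex.nonneg_iff.1 h2
  have h8 := abs_le.1 h3
  rw [h4, h5]
  simp only [Pi.add_apply, Pi.sub_apply]
  rw [h6 _ h7.1 h7.2.symm, h6, h6] <;>
    simp only [Complex.add_re, Complex.sub_re, Complex.add_im, Complex.sub_im, h1, ← h7.2] <;>
    first | (ring; done) | linarith

/-- Two positive elements of the ball of radius `R` of a predual of `L_1` have an upper bound
in the same ball, namely their supremum `(z + w + |z - w|) / 2`. -/
theorem exists_sup (hiso : ∀ g, ‖Φ g‖ = ‖g‖) (hsurj : Function.Surjective Φ)
    (hmod : HasModulus Φ) {R : ℝ} {z w : F} (hz : IsPosPredual Φ z) (hw : IsPosPredual Φ w)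
    (hzR : ‖z‖ ≤ R) (hwR : ‖w‖ ≤ R) :
    ∃ v : F, IsPosPredual Φ v ∧ ‖v‖ ≤ R ∧ IsPosPredual Φ (v - z) ∧ IsPosPredual Φ (v - w) := by
  have hR : 0 ≤ R := (norm_nonneg z).trans hzR
  obtain ⟨m, hm, hm1, hm2⟩ := hmod.exists_abs (z - w)
  have key : ∀ g : Lp ℂ 1 ν, (∀ᵐ x ∂ν, 0 ≤ (g : X → ℂ) x) →
      |(Φ g z).re - (Φ g w).re| ≤ (Φ g m).re := by
    intro g hg
    have h1 := hm1 g
    have h2 : absLp g = g := by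
      refine Lp.ext ?_
      filter_upwards [coeFn_absLp g, hg] with x h1 h2
      rw [h1]
      exact (Complex.eq_coe_norm_of_nonneg h2).symm
    rw [h2, map_sub] at h1
    rw [← Complex.sub_re]
    exact (Complex.abs_re_le_norm _).trans h1
  set v : F := (2⁻¹ : ℂ) • (z + w + m) with hv
  have hhalf : ∀ c : ℂ, ((2⁻¹ : ℂ) * c).re = c.re / 2 ∧ ((2⁻¹ : ℂ) * c).im = c.im / 2 := by
    intro c
    rw [mul_comm, ← div_eq_mul_inv]
    exact ⟨Complex.div_ofNat_re c 2, Complex.div_ofNat_im c 2⟩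
  have e : ∀ g, (Φ g v).re = ((Φ g z).re + (Φ g w).re + (Φ g m).re) / 2 ∧
      (Φ g v).im = ((Φ g z).im + (Φ g w).im + (Φ g m).im) / 2 := fun g => by
    rw [hv, map_smul, smul_eq_mul, (hhalf _).1, (hhalf _).2]
    simp
  have him : ∀ g : Lp ℂ 1 ν, (∀ᵐ x ∂ν, 0 ≤ (g : X → ℂ) x) →
      (Φ g z).im = 0 ∧ (Φ g w).im = 0 ∧ (Φ g m).im = 0 := fun g hg =>
    ⟨(Complex.nonneg_iff.1 (hz g hg)).2.symm, (Complex.nonneg_iff.1 (hw g hg)).2.symm,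
      (Complex.nonneg_iff.1 (hm g hg)).2.symm⟩
  have hvz : IsPosPredual Φ (v - z) := fun g hg => by
    have h1 := abs_le.1 (key g hg)
    obtain ⟨h2, h3, h4⟩ := him g hg
    rw [map_sub, Complex.nonneg_iff, Complex.sub_re, Complex.sub_im, (e g).1, (e g).2, h2, h3, h4]
    constructor <;> linarith
  have hvw : IsPosPredual Φ (v - w) := fun g hg => by
    have h1 := abs_le.1 (key g hg)
    obtain ⟨h2, h3, h4⟩ := him g hg
    rw [map_sub, Complex.nonneg_iff, Complex.sub_re, Complex.sub_im, (e g).1, (e g).2, h2, h3, h4]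
    constructor <;> linarith
  have hvp : IsPosPredual Φ v := by simpa using hvz.add hz
  refine ⟨v, hvp, hvp.norm_le_of_forall hiso hsurj hR fun g hg => ?_, hvz, hvw⟩
  have hbd : ∀ (h : Lp ℂ 1 ν) (u : F), ‖u‖ ≤ R → (Φ h u).re ≤ R * ‖h‖ := fun h u hu => by
    refine (Complex.re_le_norm _).trans (((Φ h).le_opNorm u).trans ?_)
    rw [hiso, mul_comm]
    gcongr
  have h1 := hm2 g hg (2 * R * ‖g‖ - ((Φ g z).re + (Φ g w).re)) fun h hh => by
    obtain ⟨c, hc, hc'⟩ := RCLike.exists_norm_eq_mul_self (Φ h (z - w))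
    set k := reLp (c • h) with hk
    have h2 : ‖Φ h (z - w)‖ = (Φ k z).re - (Φ k w).re := by
      rw [hk, hz.re_reLp, hw.re_reLp, ← Complex.sub_re, ← map_sub, map_smul, smul_apply,
        smul_eq_mul, ← hc']
      exact (Complex.ofReal_re _).symm
    have h3 : ‖g + k‖ + ‖g - k‖ = 2 * ‖g‖ := by
      refine norm_add_add_norm_sub ?_ hg ?_
      · filter_upwards [coeFn_reLp (c • h)] with x hx
        rw [hx, Complex.ofReal_im]
      · filter_upwards [coeFn_reLp (c • h), Lp.coeFn_smul c h, hh, hg] with x h1 h2 h3 h4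
        rw [h1, Complex.ofReal_re, h2, Pi.smul_apply, smul_eq_mul]
        refine (Complex.abs_re_le_norm _).trans ?_
        rw [norm_mul, hc, one_mul]
        refine h3.trans_eq ?_
        rw [← Complex.abs_re_eq_norm.2 (Complex.nonneg_iff.1 h4).2.symm,
          abs_of_nonneg (Complex.nonneg_iff.1 h4).1]
    have h4 := hbd (g + k) z hzR
    have h5 := hbd (g - k) w hwR
    rw [map_add, add_apply, Complex.add_re] at h4
    rw [map_sub, sub_apply, Complex.sub_re] at h5
    have h6 : R * ‖g + k‖ + R * ‖g - k‖ = 2 * R * ‖g‖ := by rw [← mul_add, h3]; ring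
    rw [h2]
    linarith
  rw [(e g).1]
  linarith

theorem exists_finite_sup (hiso : ∀ g, ‖Φ g‖ = ‖g‖) (hsurj : Function.Surjective Φ)
    (hmod : HasModulus Φ) {R : ℝ} (hR : 0 ≤ R) {n : ℕ} (z : Fin n → F)
    (hz : ∀ k, IsPosPredual Φ (z k)) (hzR : ∀ k, ‖z k‖ ≤ R) :
    ∃ v : F, IsPosPredual Φ v ∧ ‖v‖ ≤ R ∧ ∀ k, IsPosPredual Φ (v - z k) := by
  induction n with
  | zero => exact ⟨0, fun g _ => by simp, by simpa using hR, fun k => k.elim0⟩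
  | succ n ih =>
    obtain ⟨v, hv, hvR, hvz⟩ := ih (fun k => z k.succ) (fun k => hz _) fun k => hzR _
    obtain ⟨u, hu, huR, hu0, huv⟩ := exists_sup hiso hsurj hmod (hz 0) hv (hzR 0) hvR
    refine ⟨u, hu, huR, fun k => ?_⟩
    refine Fin.cases hu0 (fun k => ?_) k
    simpa using huv.add (hvz k)

/-- The dominating element in the case `q = 1` is the supremum of the moduli. -/
theorem exists_dominating_one (hiso : ∀ g, ‖Φ g‖ = ‖g‖) (hsurj : Function.Surjective Φ)
    (hmod : HasModulus Φ) {n : ℕ} (y : Fin n → F) {R : ℝ} (hR : 0 ≤ R) (hy : ∀ k, ‖y k‖ ≤ R) :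
    ∃ v : F, ‖v‖ ≤ R ∧ ∀ (g : Lp ℂ 1 ν) (h : Fin n → Lp ℂ 1 ν),
      (∀ᵐ x ∂ν, 0 ≤ (g : X → ℂ) x) → (∀ᵐ x ∂ν, ∑ k, ‖h k x‖ ≤ (g x).re) →
      ∑ k, ‖Φ (h k) (y k)‖ ≤ (Φ g v).re := by
  choose z hz hz1 hz2 using hmod.exists_abs
  have hzR : ∀ k, ‖z (y k)‖ ≤ R := fun k => by
    refine (hz (y k)).norm_le_of_forall hiso hsurj hR fun g hg => ?_
    refine hz2 (y k) g hg _ fun h hh => ((Φ h).le_opNorm _).trans ?_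
    rw [hiso, mul_comm]
    gcongr
    · exact hy k
    · exact Lp.norm_le_norm_of_ae_le hh
  obtain ⟨v, hv, hvR, hvz⟩ := exists_finite_sup hiso hsurj hmod hR (fun k => z (y k))
    (fun k => hz _) hzR
  refine ⟨v, hvR, fun g h hg hgh => ?_⟩
  calc ∑ k, ‖Φ (h k) (y k)‖ ≤ ∑ k, (Φ (absLp (h k)) v).re := by
        refine Finset.sum_le_sum fun k _ => (hz1 (y k) (h k)).trans ?_
        have h1 := (Complex.nonneg_iff.1 (hvz k _ (absLp_nonneg (h k)))).1
        rw [map_sub, Complex.sub_re] at h1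
        linarith
    _ = (Φ (∑ k, absLp (h k)) v).re := by
        rw [map_sum, sum_apply, Complex.re_sum]
    _ ≤ (Φ g v).re := by
        refine (Complex.le_def.1 (hv.mono ?_)).1
        have h1 : ∀ᵐ x ∂ν, ∀ k, absLp (h k) x = ((‖h k x‖ : ℝ) : ℂ) :=
          ae_all_iff.2 fun k => coeFn_absLp (h k)
        filter_upwards [h1, hg, hgh, Lp.coeFn_finsetSum Finset.univ fun k => absLp (h k)]
          with x h1 h2 h3 h4
        rw [h4, Finset.sum_apply]
        simp only [h1]
        rw [← Complex.ofReal_sum, Complex.le_def, Complex.ofReal_re, Complex.ofReal_im]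
        exact ⟨h3, (Complex.nonneg_iff.1 h2).2⟩

end PredualL1

/-! ### The identification of `L_q` with a dual space -/

section Duality

theorem conj_ne_top {q q' : ℝ≥0∞} [ENNReal.HolderConjugate q q'] (h : 1 < q) : q' ≠ ∞ :=
  fun h' => h.ne' (conj_eq_top.1 h')

theorem norm_toLp_apply_le_weakNorm_of_le {K : Type*} [TopologicalSpace K] [CompactSpace K]
    {p q : ℝ≥0∞} (hp : 1 ≤ p) (hpq : p ≤ q) (hq : q ≠ ∞)
    {n : ℕ} (f : Fin n → C(K, ℂ)) (s : K) :
    ‖(WithLp.toLp q (fun k => f k s) : PiLp q fun _ => ℂ)‖ ≤ weakNorm p f :=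
  (norm_toLp_antitone hp hpq hq _).trans
    (norm_toLp_apply_le_weakNorm hp (ne_top_of_le_ne_top hq hpq) f (evalDual s)
      (norm_evalDual_le s))

variable {X : Type*} [MeasurableSpace X] {ν : Measure X} {q q' : ℝ≥0∞} [hq1 : Fact (1 ≤ q)]
  [hq1' : Fact (1 ≤ q')] [hqq : ENNReal.HolderConjugate q q']
  {F : Type*} [NormedAddCommGroup F] [NormedSpace ℂ F]
  {Φ : Lp ℂ q ν →L[ℂ] StrongDual ℂ F}

/-- For `q > 1` the identification is the integral pairing, transported along `e`. -/
theorem eq_lqPairing {e : F ≃ₗᵢ[ℂ] Lp ℂ q' ν}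
    (he : ∀ (g : Lp ℂ q ν) (y : F), Φ g y = ∫ x, (g : X → ℂ) x * (e y : X → ℂ) x ∂ν)
    (g : Lp ℂ q ν) (y : F) : Φ g y = lqPairing ν q q' g (e y) := by
  rw [lqPairing_apply, he]

theorem IsLqDuality.norm_map (hΦ : IsLqDuality q' Φ) (hq : q ≠ ∞) (g : Lp ℂ q ν) :
    ‖Φ g‖ = ‖g‖ := by
  rcases hΦ with ⟨h1, e, he⟩ | ⟨-, h, -⟩
  · rw [← norm_lqPairing hq (conj_ne_top (q' := q') h1) g]
    have h2 : Φ g = lqPairing ν q q' g ∘L (e : F →L[ℂ] Lp ℂ q' ν) := by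
      ext y; exact eq_lqPairing he g y
    rw [h2]
    exact ContinuousLinearMap.opNorm_comp_linearIsometryEquiv _ _
  · exact h g

theorem IsLqDuality.surjective (hΦ : IsLqDuality q' Φ) (hq : q ≠ ∞) :
    Function.Surjective Φ := by
  rcases hΦ with ⟨h1, e, he⟩ | ⟨-, -, h, -⟩
  · intro ψ
    obtain ⟨g, hg⟩ := surjective_lqPairing (ν := ν) hq (conj_ne_top h1)
      (ψ ∘L (e.symm : Lp ℂ q' ν →L[ℂ] F))
    refine ⟨g, ?_⟩
    ext y
    rw [eq_lqPairing he, hg]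
    simp
  · exact h

/-- The function `(∑ |y_k|^r)^{1/r}` belongs to `L_r`. -/
theorem memLp_norm_toLp {r : ℝ≥0∞} [hr1 : Fact (1 ≤ r)] (hr : r ≠ ∞) {n : ℕ}
    (y : Fin n → Lp ℂ r ν) :
    MemLp (fun x => ((‖(WithLp.toLp r (fun k => y k x) : PiLp r fun _ => ℂ)‖ : ℝ) : ℂ)) r ν := by
  have hm : AEStronglyMeasurable
      (fun x => ((‖(WithLp.toLp r (fun k => y k x) : PiLp r fun _ => ℂ)‖ : ℝ) : ℂ)) ν := by
    refine Complex.continuous_ofReal.comp_aestronglyMeasurable ?_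
    refine ((PiLp.continuous_toLp r (fun _ : Fin n => ℂ)).norm).comp_aestronglyMeasurable ?_
    exact (aemeasurable_pi_lambda _ fun k =>
      (Lp.memLp (y k)).1.aemeasurable).aestronglyMeasurable
  rw [← integrable_norm_rpow_iff hm (zero_lt_one.trans_le hr1.out).ne' hr]
  simp only [Complex.norm_real, norm_norm, norm_toLp_rpow hr1.out hr]
  exact integrable_finsetSum _ fun k _ => integrable_norm_rpow_Lp hr (y k)

theorem norm_memLp_norm_toLp {r : ℝ≥0∞} [hr1 : Fact (1 ≤ r)] (hr : r ≠ ∞) {n : ℕ}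
    (y : Fin n → Lp ℂ r ν) :
    ‖(memLp_norm_toLp hr y).toLp _‖ = ‖(WithLp.toLp r y : PiLp r fun _ => Lp ℂ r ν)‖ := by
  have h0 := toReal_pos_of_one_le hr1.out hr
  rw [← Real.rpow_left_inj (norm_nonneg _) (norm_nonneg _) h0.ne', norm_toLp_rpow hr1.out hr,
    norm_Lp_rpow hr]
  simp_rw [norm_Lp_rpow hr]
  rw [← integral_finsetSum _ fun k _ => integrable_norm_rpow_Lp hr (y k)]
  refine integral_congr_ae ?_
  filter_upwards [(memLp_norm_toLp hr y).coeFn_toLp] with x hx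
  rw [hx, Complex.norm_real, norm_norm, norm_toLp_rpow hr1.out hr]

/-- The dominating element in the case `q > 1` is `(∑ |y_k|^{q'})^{1/q'}`. -/
theorem exists_dominating_of_one_lt (hq : q ≠ ∞) (h1 : 1 < q) {e : F ≃ₗᵢ[ℂ] Lp ℂ q' ν}
    (he : ∀ (g : Lp ℂ q ν) (y : F), Φ g y = ∫ x, (g : X → ℂ) x * (e y : X → ℂ) x ∂ν)
    {n : ℕ} (y : Fin n → F) :
    ∃ v : F, ‖v‖ ≤ ‖(WithLp.toLp q' y : PiLp q' fun _ => F)‖ ∧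
      ∀ (g : Lp ℂ q ν) (h : Fin n → Lp ℂ q ν), (∀ᵐ x ∂ν,
        ‖(WithLp.toLp q (fun k => h k x) : PiLp q fun _ => ℂ)‖ ≤ (g x).re) →
      ∑ k, ‖Φ (h k) (y k)‖ ≤ (Φ g v).re := by
  have hq' : q' ≠ ∞ := conj_ne_top h1
  set w := (memLp_norm_toLp hq' fun k => e (y k)).toLp _ with hw
  refine ⟨e.symm w, ?_, fun g h hgh => ?_⟩
  · rw [LinearIsometryEquiv.norm_map, hw, norm_memLp_norm_toLp hq']
    exact norm_toLp_mono hq1'.out fun k => (e.norm_map _).le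
  · rw [he, LinearIsometryEquiv.apply_symm_apply]
    have hi := integrable_Lp_mul g w
    have e1 : (∫ x, g x * w x ∂ν).re = ∫ x, (g x * w x).re ∂ν := (integral_re hi).symm
    have hk : ∀ k, Integrable (fun x => ‖h k x * e (y k) x‖) ν := fun k =>
      (integrable_Lp_mul (h k) (e (y k))).norm
    rw [e1]
    calc ∑ k, ‖Φ (h k) (y k)‖ ≤ ∑ k, ∫ x, ‖h k x * e (y k) x‖ ∂ν := by
          gcongr with k
          rw [he]
          exact norm_integral_le_integral_norm _
      _ = ∫ x, ∑ k, ‖h k x * e (y k) x‖ ∂ν := (integral_finsetSum _ fun k _ => hk k).symm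
      _ ≤ _ := by
          refine integral_mono_ae (integrable_finsetSum _ fun k _ => hk k) hi.re ?_
          filter_upwards [hgh, (memLp_norm_toLp hq' fun k => e (y k)).coeFn_toLp] with x h2 h3
          rw [hw]
          simp only [norm_mul]
          rw [h3]
          refine (sum_norm_mul_norm_le (q := q) (q' := q') hq (fun k => h k x)
            fun k => e (y k) x).trans ?_
          change _ ≤ (g x * _).re
          rw [Complex.re_mul_ofReal]
          gcongr

/-- Every finite family in `F` is dominated by a single element `v`, of norm at most the
`ℓ_{q'}`-norm of the family: pairing with `v` controls the sum of the pairings with the family. This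
combines Hölder's inequality in `L_q` with the lattice structure of `F`. -/
theorem IsLqDuality.exists_dominating (hΦ : IsLqDuality q' Φ) (hq : q ≠ ∞)
    {n : ℕ} (y : Fin n → F) :
    ∃ v : F, ‖v‖ ≤ ‖(WithLp.toLp q' y : PiLp q' fun _ => F)‖ ∧
      ∀ (g : Lp ℂ q ν) (h : Fin n → Lp ℂ q ν), (∀ᵐ x ∂ν, 0 ≤ (g : X → ℂ) x) → (∀ᵐ x ∂ν,
        ‖(WithLp.toLp q (fun k => h k x) : PiLp q fun _ => ℂ)‖ ≤ (g x).re) →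
      ∑ k, ‖Φ (h k) (y k)‖ ≤ (Φ g v).re := by
  rcases hΦ with ⟨h1, e, he⟩ | ⟨h1, hiso, hsurj, hmod⟩
  · obtain ⟨v, hv, hv'⟩ := exists_dominating_of_one_lt hq h1 he y
    exact ⟨v, hv, fun g h _ => hv' g h⟩
  · subst h1
    obtain rfl : q' = ∞ := (conj_eq_top (q := 1)).2 rfl
    obtain ⟨v, hv, hv'⟩ := exists_dominating_one hiso hsurj hmod y
      (norm_nonneg (WithLp.toLp ∞ y : PiLp ∞ fun _ => F)) fun k => by
        simpa using PiLp.norm_apply_le (WithLp.toLp ∞ y : PiLp ∞ fun _ => F) k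
    refine ⟨v, hv, fun g h hg hgh => hv' g h hg ?_⟩
    filter_upwards [hgh] with x hx
    rwa [norm_toLp_one] at hx

variable {K : Type*} [TopologicalSpace K] [CompactSpace K]

/-- The domination of finite sums that is integrated over `Ω`. -/
theorem IsLqDuality.exists_dominating_positive (hΦ : IsLqDuality q' Φ) (hq : q ≠ ∞)
    {n : ℕ} (y : Fin n → F) :
    ∃ v : F, ‖v‖ ≤ ‖(WithLp.toLp q' y : PiLp q' fun _ => F)‖ ∧
      ∀ T : C(K, ℂ) →L[ℂ] Lp ℂ q ν, IsPositiveOp T → ∀ (f : Fin n → C(K, ℂ)) (M : ℝ), 0 ≤ M →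
      (∀ s, ‖(WithLp.toLp q (fun k => f k s) : PiLp q fun _ => ℂ)‖ ≤ M) →
      ∑ k, ‖Φ (T (f k)) (y k)‖ ≤ M * (Φ (T 1) v).re := by
  obtain ⟨v, hv, hv'⟩ := hΦ.exists_dominating hq y
  refine ⟨v, hv, fun T hT f M hM hf => ?_⟩
  have h1 := hv' ((M : ℂ) • T 1) (fun k => T (f k)) (by
    filter_upwards [hT.one_nonneg, Lp.coeFn_smul (M : ℂ) (T 1)] with x h1 h2
    rw [h2]
    exact mul_nonneg (Complex.zero_le_real.2 hM) h1) (by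
    filter_upwards [hT.norm_toLp_le q' hq f hM hf, Lp.coeFn_smul (M : ℂ) (T 1)] with x h1 h2
    rw [h2, Pi.smul_apply, smul_eq_mul, Complex.re_ofReal_mul]
    exact h1)
  rwa [map_smul, smul_apply, smul_eq_mul, Complex.re_ofReal_mul] at h1

/-- An operator into `L_q` is `(q,p)`-summing as soon as it satisfies the dual form of the defining
inequality. -/
theorem IsLqDuality.isSumming (hΦ : IsLqDuality q' Φ) (hq : q ≠ ∞) {p : ℝ≥0∞}
    {E : Type*} [NormedAddCommGroup E] [NormedSpace ℂ E] (T : E →L[ℂ] Lp ℂ q ν) {D : ℝ}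
    (hD : 0 ≤ D) (h : ∀ (n : ℕ) (x : Fin n → E) (y : Fin n → F),
      ∑ k, ‖Φ (T (x k)) (y k)‖ ≤
        D * weakNorm p x * ‖(WithLp.toLp q' y : PiLp q' fun _ => F)‖) :
    IsSumming q p T := by
  refine ⟨2 * D + 1, by positivity, fun n x => ?_⟩
  rw [← norm_toLp_eq_sum hq1.out hq]
  have hw := weakNorm_nonneg p x
  refine (norm_toLp_le_of_forall (q' := q') hq _ (D := 2 * D * weakNorm p x) (by positivity)
    fun c hc => ?_).trans (by nlinarith)
  -- Each norm `‖T x_k‖` is attained up to a factor two on the unit ball of `F`.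
  have hy : ∀ k, ∃ y : F, ‖y‖ ≤ 1 ∧ ‖T (x k)‖ ≤ 2 * ‖Φ (T (x k)) y‖ := fun k => by
    rcases eq_or_ne (T (x k)) 0 with h0 | h0
    · exact ⟨0, by simp, by simp [h0]⟩
    · have h1 : ‖T (x k)‖ / 2 < ‖Φ (T (x k))‖ := by
        rw [hΦ.norm_map hq]
        exact half_lt_self (norm_pos_iff.2 h0)
      obtain ⟨y, hy, hy'⟩ := (Φ (T (x k))).exists_lt_apply_of_lt_opNorm h1
      exact ⟨y, hy.le, by linarith⟩
  choose y hy1 hy2 using hy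
  calc ∑ k, c k * ‖T (x k)‖ ≤ ∑ k, 2 * ‖Φ (T (x k)) ((c k : ℂ) • y k)‖ := by
        refine Finset.sum_le_sum fun k _ => ?_
        rw [map_smul, norm_smul, Complex.norm_real, Real.norm_of_nonneg (hc k)]
        have := mul_le_mul_of_nonneg_left (hy2 k) (hc k)
        linarith
    _ ≤ 2 * (D * weakNorm p x * ‖(WithLp.toLp q' fun k => (c k : ℂ) • y k :
          PiLp q' fun _ => F)‖) := by
        rw [← Finset.mul_sum]
        gcongr
        exact h n x _
    _ ≤ 2 * (D * weakNorm p x * ‖(WithLp.toLp q' c : PiLp q' fun _ => ℝ)‖) := by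
        gcongr
        refine norm_toLp_mono hq1'.out fun k => ?_
        rw [norm_smul, Complex.norm_real]
        exact mul_le_of_le_one_right (norm_nonneg _) (hy1 k)
    _ = _ := by ring

/-- Positive operators into `L_q` satisfy the dual form of the `(q,p)`-summing inequality. -/
theorem IsLqDuality.sum_norm_le_of_isPositiveOp (hΦ : IsLqDuality q' Φ) {p : ℝ≥0∞} (hp : 1 ≤ p)
    (hpq : p ≤ q) (hq : q ≠ ∞) {T : C(K, ℂ) →L[ℂ] Lp ℂ q ν} (hT : IsPositiveOp T) {n : ℕ}
    (f : Fin n → C(K, ℂ)) (y : Fin n → F) :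
    ∑ k, ‖Φ (T (f k)) (y k)‖ ≤
      ‖T 1‖ * weakNorm p f * ‖(WithLp.toLp q' y : PiLp q' fun _ => F)‖ := by
  obtain ⟨v, hv, hv'⟩ := hΦ.exists_dominating_positive (K := K) hq y
  refine (hv' T hT f _ (weakNorm_nonneg p f)
    (norm_toLp_apply_le_weakNorm_of_le hp hpq hq f)).trans ?_
  have h1 : (Φ (T 1) v).re ≤ ‖T 1‖ * ‖(WithLp.toLp q' y : PiLp q' fun _ => F)‖ := by
    refine (Complex.re_le_norm _).trans (((Φ (T 1)).le_opNorm v).trans ?_)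
    rw [hΦ.norm_map hq]
    gcongr
  calc weakNorm p f * (Φ (T 1) v).re
      ≤ weakNorm p f * (‖T 1‖ * ‖(WithLp.toLp q' y : PiLp q' fun _ => F)‖) := by
        gcongr
        exact weakNorm_nonneg p f
    _ = _ := by ring

end Duality

/-! ### Limits in `L_1` and weak* integrable functions -/

section Integration

variable {Ω : Type*} [MeasurableSpace Ω] {μ : Measure Ω}

/-- Limits in `L_1` and limits almost everywhere coincide. -/
theorem ae_eq_of_tendsto_L1 {U : ℕ → Lp ℂ 1 μ} {V : Lp ℂ 1 μ} {g : Ω → ℂ}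
    (hU : Tendsto U atTop (𝓝 V)) (hg : ∀ᵐ t ∂μ, Tendsto (fun k => U k t) atTop (𝓝 (g t))) :
    V =ᵐ[μ] g := by
  obtain ⟨ns, hns, hlim⟩ := (tendstoInMeasure_of_tendsto_Lp hU).exists_seq_tendsto_ae
  filter_upwards [hlim, hg] with t h1 h2
  exact tendsto_nhds_unique h1 (h2.comp hns.tendsto_atTop)

/-- For a weak* integrable `u : Ω → F^*` the operator `y ↦ ⟨u, y⟩` from `F` to `L_1(μ)` is bounded,
by the closed graph theorem. -/
theorem exists_integral_norm_le {F : Type*} [NormedAddCommGroup F] [NormedSpace ℂ F]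
    [CompleteSpace F] {u : Ω → StrongDual ℂ F} (hu : ∀ y, Integrable (fun t => u t y) μ) :
    ∃ C : ℝ, 0 < C ∧ ∀ y, ∫ t, ‖u t y‖ ∂μ ≤ C * ‖y‖ := by
  let L : F →ₗ[ℂ] Lp ℂ 1 μ :=
    { toFun := fun y => (hu y).toL1 _
      map_add' := fun y z => by
        rw [← Integrable.toL1_add]
        exact (Integrable.toL1_eq_toL1_iff _ _ _ _).2 (ae_of_all _ fun t => map_add _ _ _)
      map_smul' := fun c y => by
        rw [RingHom.id_apply, ← Integrable.toL1_smul]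
        exact (Integrable.toL1_eq_toL1_iff _ _ _ _).2 (ae_of_all _ fun t => map_smul _ _ _) }
  have hL : Continuous L := by
    refine L.continuous_of_seq_closed_graph fun v y V hv hV => ?_
    have h1 : ∀ᵐ t ∂μ, ∀ k, L (v k) t = u t (v k) :=
      ae_all_iff.2 fun k => (hu (v k)).coeFn_toL1
    have h2 : V =ᵐ[μ] fun t => u t y := ae_eq_of_tendsto_L1 hV (by
      filter_upwards [h1] with t ht
      simp only [Function.comp_apply, ht]
      exact ((u t).continuous.tendsto y).comp hv)
    refine Lp.ext (h2.trans (hu y).coeFn_toL1.symm)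
  obtain ⟨C, hC, hC'⟩ := (⟨L, hL⟩ : F →L[ℂ] Lp ℂ 1 μ).bound
  refine ⟨C, hC, fun y => ?_⟩
  have h1 := hC' y
  rwa [show ‖(⟨L, hL⟩ : F →L[ℂ] Lp ℂ 1 μ) y‖ = ∫ t, ‖u t y‖ ∂μ from
    L1.norm_of_fun_eq_integral_norm (hu y)] at h1

/-- A series of functions whose `L_1`-norms are summable is almost everywhere absolutely summable,
with integrable sum of the absolute values. -/
theorem ae_summable_and_integrable_tsum {u : ℕ → Ω → ℂ} (hu : ∀ n, Integrable (u n) μ)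
    (hsum : Summable fun n => ∫ t, ‖u n t‖ ∂μ) :
    (∀ᵐ t ∂μ, Summable fun n => ‖u n t‖) ∧ Integrable (fun t => ∑' n, ‖u n t‖) μ := by
  let U : ℕ → Lp ℝ 1 μ := fun n => (hu n).norm.toL1 _
  have hUn : ∀ n, ‖U n‖ = ∫ t, ‖u n t‖ ∂μ := fun n => by
    rw [L1.norm_of_fun_eq_integral_norm]; simp
  have hfin : ∑' n, ‖U n‖ₑ ≠ ∞ := by
    have h1 : ∀ n, ‖U n‖ₑ = ENNReal.ofReal (∫ t, ‖u n t‖ ∂μ) := fun n => by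
      rw [← hUn, ofReal_norm]
    simp_rw [h1]
    exact hsum.tsum_ofReal_ne_top
  have h2 : ∀ᵐ t ∂μ, ∀ n, U n t = ‖u n t‖ := ae_all_iff.2 fun n => (hu n).norm.coeFn_toL1
  have h3 := Lp.hasSum_coeFn_tsum hfin
  refine ⟨?_, (L1.integrable_coeFn (∑' n, U n)).congr ?_⟩
  · filter_upwards [h2, h3] with t h2 h3
    simp only [h2] at h3
    exact h3.summable
  · filter_upwards [h2, h3] with t h2 h3
    simp only [h2] at h3
    exact h3.tsum_eq.symm

end Integration

section Tensor

variable {E F : Type*} [NormedAddCommGroup E] [NormedSpace ℂ E]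
  [NormedAddCommGroup F] [NormedSpace ℂ F]

theorem tensorPairing_tmul (T : E →L[ℂ] StrongDual ℂ F) (x : E) (y : F) :
    tensorPairing T (x ⊗ₜ[ℂ] y) = T x y := by
  simp [tensorPairing]

theorem tensorPairing_sum (T : E →L[ℂ] StrongDual ℂ F) {n : ℕ} (x : Fin n → E) (y : Fin n → F) :
    tensorPairing T (∑ j, x j ⊗ₜ[ℂ] y j) = ∑ j, T (x j) (y j) := by
  simp [map_sum, tensorPairing_tmul]

theorem exists_eq_sum_tmul (z : E ⊗[ℂ] F) :
    ∃ (n : ℕ) (x : Fin n → E) (y : Fin n → F), z = ∑ j, x j ⊗ₜ[ℂ] y j := by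
  obtain ⟨S, hS⟩ := TensorProduct.exists_finset z
  refine ⟨S.card, fun j => (S.equivFin.symm j).1.1, fun j => (S.equivFin.symm j).1.2, ?_⟩
  rw [hS, ← Finset.sum_coe_sort]
  exact (Equiv.sum_comp S.equivFin.symm fun i : S => i.1.1 ⊗ₜ[ℂ] i.1.2).symm

theorem le_mul_csInf {s : Set ℝ} (hs : s.Nonempty) {C I : ℝ} (hC : 0 < C)
    (h : ∀ r ∈ s, I ≤ C * r) : I ≤ C * sInf s := by
  rw [← div_le_iff₀' hC]
  exact le_csInf hs fun r hr => (div_le_iff₀' hC).2 (h r hr)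

theorem le_mul_projNorm {C I : ℝ} (hC : 0 < C) (z : E ⊗[ℂ] F)
    (h : ∀ (n : ℕ) (x : Fin n → E) (y : Fin n → F), z = ∑ j, x j ⊗ₜ[ℂ] y j →
      I ≤ C * ∑ j, ‖x j‖ * ‖y j‖) : I ≤ C * projNorm z := by
  refine le_mul_csInf ?_ hC ?_
  · obtain ⟨n, x, y, hz⟩ := exists_eq_sum_tmul z
    exact ⟨_, n, x, y, hz, rfl⟩
  · rintro _ ⟨n, x, y, hz, rfl⟩
    exact h n x y hz

theorem le_mul_chevetSaphar {p p' : ℝ≥0∞} {C I : ℝ} (hC : 0 < C) (z : E ⊗[ℂ] F)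
    (h : ∀ (n : ℕ) (x : Fin n → E) (y : Fin n → F), z = ∑ j, x j ⊗ₜ[ℂ] y j →
      I ≤ C * (weakNorm p x * ‖(WithLp.toLp p' y : PiLp p' fun _ => F)‖)) :
    I ≤ C * chevetSaphar p p' z := by
  refine le_mul_csInf ?_ hC ?_
  · obtain ⟨n, x, y, hz⟩ := exists_eq_sum_tmul z
    exact ⟨_, n, x, y, hz, rfl⟩
  · rintro _ ⟨n, x, y, hz, rfl⟩
    exact h n x y hz

theorem projNorm_zero_le : projNorm (0 : E ⊗[ℂ] F) ≤ 0 := by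
  refine csInf_le ⟨0, ?_⟩ ⟨0, Fin.elim0, Fin.elim0, by simp, by simp⟩
  rintro _ ⟨n, x, y, -, rfl⟩
  positivity

theorem isCauchyFor_const (z : E ⊗[ℂ] F) : IsCauchyFor projNorm fun _ => z := fun ε hε =>
  ⟨0, fun m _ n _ => by rw [sub_self]; exact projNorm_zero_le.trans_lt hε⟩

variable {Ω : Type*} [MeasurableSpace Ω] {μ : Measure Ω} {B : Ω → E →L[ℂ] StrongDual ℂ F}

theorem IsGelfandIntegrable.integrable_tensorPairing (hB : IsGelfandIntegrable projNorm μ B)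
    (z : E ⊗[ℂ] F) : Integrable (fun t => tensorPairing (B t) z) μ := by
  obtain ⟨g, hg, hlim⟩ := hB _ (isCauchyFor_const z)
  refine hg.congr ?_
  filter_upwards [hlim] with t ht
  exact tendsto_nhds_unique ht tendsto_const_nhds

/-- If the pairing is bounded from `(E ⊗ F, α)` to `L_1(μ)`, it extends to the completion:
along Cauchy sequences, almost everywhere limits are limits in `L_1(μ)`. -/
theorem integrable_and_tendsto_of_isCauchyFor {α : E ⊗[ℂ] F → ℝ}
    (hB : ∀ z, Integrable (fun t => tensorPairing (B t) z) μ) {C : ℝ} (hC : 0 < C)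
    (hα : ∀ z, ∫ t, ‖tensorPairing (B t) z‖ ∂μ ≤ C * α z) {z : ℕ → E ⊗[ℂ] F}
    (hz : IsCauchyFor α z) {g : Ω → ℂ}
    (hg : ∀ᵐ t ∂μ, Tendsto (fun k => tensorPairing (B t) (z k)) atTop (𝓝 (g t))) :
    Integrable g μ ∧ ∀ S : Set Ω,
      Tendsto (fun k => ∫ t in S, tensorPairing (B t) (z k) ∂μ) atTop (𝓝 (∫ t in S, g t ∂μ)) := by
  let U : ℕ → Lp ℂ 1 μ := fun k => (hB (z k)).toL1 _
  have hU : CauchySeq U := by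
    rw [Metric.cauchySeq_iff]
    intro ε hε
    obtain ⟨N, hN⟩ := hz (ε / C) (by positivity)
    refine ⟨N, fun m hm n hn => ?_⟩
    have h1 : U m - U n = (hB (z m - z n)).toL1 _ := by
      rw [← Integrable.toL1_sub]
      exact (Integrable.toL1_eq_toL1_iff _ _ _ _).2 (ae_of_all _ fun t => (map_sub _ _ _).symm)
    rw [dist_eq_norm, h1, L1.norm_of_fun_eq_integral_norm]
    calc _ ≤ C * α (z m - z n) := hα _
      _ < C * (ε / C) := by gcongr; exact hN m hm n hn
      _ = ε := by field_simp
  obtain ⟨V, hV⟩ := cauchySeq_tendsto_of_complete hU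
  have hUk : ∀ᵐ t ∂μ, ∀ k, U k t = tensorPairing (B t) (z k) :=
    ae_all_iff.2 fun k => (hB (z k)).coeFn_toL1
  have hVg : V =ᵐ[μ] g := ae_eq_of_tendsto_L1 hV (by
    filter_upwards [hUk, hg] with t h1 h2
    simpa only [h1] using h2)
  refine ⟨(L1.integrable_coeFn V).congr hVg, fun S => ?_⟩
  have h1 := ((continuous_setIntegral S).tendsto V).comp hV
  rw [← integral_congr_ae (ae_restrict_of_ae hVg)]
  refine h1.congr fun k => integral_congr_ae (ae_restrict_of_ae ?_)
  exact (hB (z k)).coeFn_toL1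

theorem tensorPairing_eq_setIntegral (hB : ∀ z, Integrable (fun t => tensorPairing (B t) z) μ)
    {S : Set Ω} {T : E →L[ℂ] StrongDual ℂ F} (hT : ∀ x y, T x y = ∫ t in S, B t x y ∂μ)
    (z : E ⊗[ℂ] F) : tensorPairing T z = ∫ t in S, tensorPairing (B t) z ∂μ := by
  obtain ⟨n, x, y, rfl⟩ := exists_eq_sum_tmul z
  simp_rw [tensorPairing_sum, hT]
  refine (integral_finsetSum _ fun j _ => ?_).symm
  have := (hB (x j ⊗ₜ[ℂ] y j)).restrict (s := S)
  simpa only [tensorPairing_tmul] using this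

end Tensor

/-! ### Weak* integrals of positive operators -/

section Main

variable {Ω : Type*} [MeasurableSpace Ω] {μ : Measure Ω}
  {K : Type*} [TopologicalSpace K] [CompactSpace K]
  {X : Type*} [MeasurableSpace X] {ν : Measure X}
  {p q q' : ℝ≥0∞} [hq1 : Fact (1 ≤ q)] [hq1' : Fact (1 ≤ q')] [hqq : ENNReal.HolderConjugate q q']
  {F : Type*} [NormedAddCommGroup F] [NormedSpace ℂ F]
  {Φ : Lp ℂ q ν →L[ℂ] StrongDual ℂ F} {A : Ω → C(K, ℂ) →L[ℂ] Lp ℂ q ν}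

/-- The integrated domination estimate: the pairings of `A` with two finite families are controlled
in `L_1(μ)` by the `ℓ_q`-norm of the first and the `ℓ_{q'}`-norm of the second. Only the weak*
integrability of `t ↦ A_t 1` enters. -/
theorem exists_integral_sum_norm_le [CompleteSpace F] (hΦ : IsLqDuality q' Φ) (hq : q ≠ ∞)
    (hint : ∀ f y, Integrable (fun t => Φ (A t f) y) μ)
    (hpos : ∀ᵐ t ∂μ, IsPositiveOp (A t)) :
    ∃ C : ℝ, 0 < C ∧ ∀ (n : ℕ) (f : Fin n → C(K, ℂ)) (y : Fin n → F) (M : ℝ), 0 ≤ M →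
      (∀ s, ‖(WithLp.toLp q (fun k => f k s) : PiLp q fun _ => ℂ)‖ ≤ M) →
      ∑ k, ∫ t, ‖Φ (A t (f k)) (y k)‖ ∂μ ≤
        C * M * ‖(WithLp.toLp q' y : PiLp q' fun _ => F)‖ := by
  obtain ⟨C, hC, hC'⟩ := exists_integral_norm_le (u := fun t => Φ (A t 1)) (hint 1)
  refine ⟨C, hC, fun n f y M hM hf => ?_⟩
  obtain ⟨v, hv, hv'⟩ := hΦ.exists_dominating_positive (K := K) hq y
  rw [← integral_finsetSum _ fun k _ => (hint (f k) (y k)).norm]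
  calc ∫ t, ∑ k, ‖Φ (A t (f k)) (y k)‖ ∂μ ≤ ∫ t, M * ‖Φ (A t 1) v‖ ∂μ := by
        refine integral_mono_ae (integrable_finsetSum _ fun k _ => (hint (f k) (y k)).norm)
          ((hint 1 v).norm.const_mul M) ?_
        filter_upwards [hpos] with t ht
        refine (hv' (A t) ht f M hM hf).trans ?_
        gcongr
        exact Complex.re_le_norm _
    _ ≤ M * (C * ‖(WithLp.toLp q' y : PiLp q' fun _ => F)‖) := by
        rw [integral_const_mul]
        gcongr
        exact (hC' v).trans (by gcongr)
    _ = _ := by ring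

/-- The integral of `A` over `S` exists as a bounded operator as soon as the pairings with `A` are
bounded in `L_1(μ)` as a bilinear form. -/
theorem exists_operator_setIntegral (hΦ : IsLqDuality q' Φ) (hq : q ≠ ∞)
    (hint : ∀ f y, Integrable (fun t => Φ (A t f) y) μ) {C : ℝ}
    (hC : ∀ f y, ∫ t, ‖Φ (A t f) y‖ ∂μ ≤ C * ‖f‖ * ‖y‖) (S : Set Ω) :
    ∃ T : C(K, ℂ) →L[ℂ] Lp ℂ q ν, ∀ f y, Φ (T f) y = ∫ t in S, Φ (A t f) y ∂μ := by
  have hi : ∀ f y, Integrable (fun t => Φ (A t f) y) (μ.restrict S) := fun f y =>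
    (hint f y).restrict
  let b : C(K, ℂ) →ₗ[ℂ] F →ₗ[ℂ] ℂ := LinearMap.mk₂ ℂ (fun f y => ∫ t in S, Φ (A t f) y ∂μ)
    (fun f f' y => by
      rw [← integral_add (hi f y) (hi f' y)]; simp)
    (fun c f y => by rw [smul_eq_mul, ← integral_const_mul]; simp)
    (fun f y y' => by
      rw [← integral_add (hi f y) (hi f y')]; simp)
    (fun c f y => by rw [smul_eq_mul, ← integral_const_mul]; simp)
  let T₀ : C(K, ℂ) →L[ℂ] StrongDual ℂ F := b.mkContinuous₂ C fun f y => by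
    refine (norm_integral_le_integral_norm _).trans (le_trans ?_ (hC f y))
    exact setIntegral_le_integral (hint f y).norm (ae_of_all _ fun _ => norm_nonneg _)
  let e : Lp ℂ q ν ≃ₗᵢ[ℂ] StrongDual ℂ F := LinearIsometryEquiv.ofSurjective
    ⟨Φ.toLinearMap, hΦ.norm_map hq⟩ (hΦ.surjective hq)
  refine ⟨(e.symm : StrongDual ℂ F →L[ℂ] Lp ℂ q ν) ∘L T₀, fun f y => ?_⟩
  have h1 : Φ (e.symm (T₀ f)) = T₀ f := e.apply_symm_apply (T₀ f)
  change Φ (e.symm (T₀ f)) y = _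
  rw [h1]
  rfl

theorem integral_norm_tensorPairing_le (hint : ∀ f y, Integrable (fun t => Φ (A t f) y) μ)
    {n : ℕ} (x : Fin n → C(K, ℂ)) (y : Fin n → F) :
    ∫ t, ‖tensorPairing (Φ ∘L A t) (∑ j, x j ⊗ₜ[ℂ] y j)‖ ∂μ ≤
      ∑ j, ∫ t, ‖Φ (A t (x j)) (y j)‖ ∂μ := by
  rw [← integral_finsetSum _ fun k _ => (hint (x k) (y k)).norm]
  simp_rw [tensorPairing_sum]
  refine integral_mono (integrable_finsetSum _ fun k _ => hint (x k) (y k)).norm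
    (integrable_finsetSum _ fun k _ => (hint (x k) (y k)).norm) fun t => ?_
  exact norm_sum_le _ _

theorem summabilityCondition_of_isPositiveOp [CompleteSpace F] (hΦ : IsLqDuality q' Φ)
    (hp : 1 ≤ p) (hpq : p ≤ q) (hq : q ≠ ∞)
    (hint : ∀ f y, Integrable (fun t => Φ (A t f) y) μ)
    (hpos : ∀ᵐ t ∂μ, IsPositiveOp (A t)) :
    SummabilityCondition p q' μ (fun t => Φ ∘L A t) := by
  intro f y hf hy
  obtain ⟨C, hC, hC'⟩ := exists_integral_sum_norm_le hΦ hq hint hpos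
  obtain ⟨M, hM, hM'⟩ := hf.exists_bound hp (ne_top_of_le_ne_top hq hpq)
  obtain ⟨D, hD, hD'⟩ := exists_norm_toLp_initial_le hq1'.out hy
  refine ae_summable_and_integrable_tsum (fun n => hint (f n) (y n)) ?_
  refine summable_of_sum_range_le (c := C * M * D)
    (fun n => integral_nonneg fun _ => norm_nonneg _) fun N => ?_
  change ∑ n ∈ Finset.range N, ∫ t, ‖Φ (A t (f n)) (y n)‖ ∂μ ≤ _
  rw [← Fin.sum_univ_eq_sum_range (fun n => ∫ t, ‖Φ (A t (f n)) (y n)‖ ∂μ)]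
  refine (hC' N (fun k => f k) (fun k => y k) M hM fun s => ?_).trans (by gcongr; exact hD' N)
  refine (norm_toLp_antitone hp hpq hq _).trans ((hM' (evalDual s) N).trans ?_)
  exact mul_le_of_le_one_right hM (norm_evalDual_le s)

end Main

end GelfandSumming

open GelfandSumming in
theorem mainTheorem4
    {Ω : Type*} [MeasurableSpace Ω] (μ : Measure Ω)
    {K : Type*} [TopologicalSpace K] [CompactSpace K]
    {X : Type*} [MeasurableSpace X] (ν : Measure X)
    (p q q' : ℝ≥0∞) [Fact (1 ≤ q)] [Fact (1 ≤ q')] [ENNReal.HolderConjugate q q']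
    (hp : 1 ≤ p) (hpq : p ≤ q) (hq : q ≠ ∞)
    {F : Type*} [NormedAddCommGroup F] [NormedSpace ℂ F] [CompleteSpace F]
    (Φ : Lp ℂ q ν →L[ℂ] StrongDual ℂ F) (hΦ : GelfandSumming.IsLqDuality q' Φ)
    (A : Ω → C(K, ℂ) →L[ℂ] Lp ℂ q ν)
    (hA : GelfandSumming.IsGelfandIntegrable GelfandSumming.projNorm μ fun t => Φ ∘L A t)
    (hpos : ∀ᵐ t ∂μ, GelfandSumming.IsPositiveOp (A t)) :
    (∀ S : Set Ω, MeasurableSet S →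
      ∃ T : C(K, ℂ) →L[ℂ] Lp ℂ q ν,
        GelfandSumming.IsGelfandIntegral GelfandSumming.projNorm μ
          (fun t => Φ ∘L A t) S (Φ ∘L T) ∧
        (∀ T' : C(K, ℂ) →L[ℂ] Lp ℂ q ν,
          GelfandSumming.IsGelfandIntegral GelfandSumming.projNorm μ
            (fun t => Φ ∘L A t) S (Φ ∘L T') → T' = T) ∧
        GelfandSumming.IsSumming q p T) ∧
    GelfandSumming.SummabilityCondition p q' μ (fun t => Φ ∘L A t) ∧
    (p = q →
      (∀ᵐ t ∂μ, GelfandSumming.IsSumming p p (A t)) ∧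
      GelfandSumming.IsGelfandIntegrable (GelfandSumming.chevetSaphar p q') μ
        fun t => Φ ∘L A t) := by
  have hpair := hA.integrable_tensorPairing
  have hint : ∀ f y, Integrable (fun t => Φ (A t f) y) μ := fun f y => by
    refine (hpair (f ⊗ₜ[ℂ] y)).congr (ae_of_all _ fun t => ?_)
    exact tensorPairing_tmul _ _ _
  obtain ⟨C, hC, hC'⟩ := exists_integral_sum_norm_le hΦ hq hint hpos
  have hweak : ∀ (n : ℕ) (f : Fin n → C(K, ℂ)) (y : Fin n → F),
      ∑ k, ∫ t, ‖Φ (A t (f k)) (y k)‖ ∂μ ≤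
        C * weakNorm p f * ‖(WithLp.toLp q' y : PiLp q' fun _ => F)‖ := fun n f y =>
    hC' n f y _ (weakNorm_nonneg p f) (norm_toLp_apply_le_weakNorm_of_le hp hpq hq f)
  have hC1 : ∀ f y, ∫ t, ‖Φ (A t f) y‖ ∂μ ≤ C * ‖f‖ * ‖y‖ := fun f y => by
    have h1 := hC' 1 (fun _ => f) (fun _ => y) ‖f‖ (norm_nonneg _) fun s => by
      rw [norm_toLp_fin_one Fact.out]
      exact f.norm_coe_le_norm s
    rwa [Fin.sum_univ_one, norm_toLp_fin_one Fact.out] at h1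
  refine ⟨fun S hS => ?_, summabilityCondition_of_isPositiveOp hΦ hp hpq hq hint hpos,
    fun hpq' => ⟨?_, fun z hz => ?_⟩⟩
  · obtain ⟨T, hT⟩ := exists_operator_setIntegral hΦ hq hint hC1 S
    refine ⟨T, fun z hz => ?_, fun T' hT' => ?_, ?_⟩
    · obtain ⟨g, hg, hlim⟩ := hA z hz
      refine ⟨g, hg, hlim, ?_⟩
      have hproj : ∀ z, ∫ t, ‖tensorPairing (Φ ∘L A t) z‖ ∂μ ≤ C * projNorm z := fun z =>
        le_mul_projNorm hC z fun n x y hz => by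
          rw [hz, Finset.mul_sum]
          refine (integral_norm_tensorPairing_le hint x y).trans (Finset.sum_le_sum fun j _ => ?_)
          rw [← mul_assoc]
          exact hC1 _ _
      refine ((integrable_and_tendsto_of_isCauchyFor hpair hC hproj hz hlim).2 S).congr fun k => ?_
      exact (tensorPairing_eq_setIntegral hpair (T := Φ ∘L T) hT (z k)).symm
    · ext1 f
      have hinj : Function.Injective Φ :=
        (AddMonoidHomClass.isometry_of_norm Φ (hΦ.norm_map hq)).injective
      refine hinj ?_
      ext y
      rw [hT]
      obtain ⟨g, -, hlim, hlim'⟩ := hT' _ (isCauchyFor_const (f ⊗ₜ[ℂ] y))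
      have h1 := tendsto_nhds_unique tendsto_const_nhds hlim'
      rw [tensorPairing_tmul] at h1
      refine h1.trans (integral_congr_ae (ae_restrict_of_ae ?_))
      filter_upwards [hlim] with t ht
      rw [← tendsto_nhds_unique tendsto_const_nhds ht, tensorPairing_tmul]
      rfl
    · refine hΦ.isSumming hq T hC.le fun n f y => le_trans ?_ (hweak n f y)
      gcongr with k
      rw [hT]
      refine (norm_integral_le_integral_norm _).trans ?_
      exact setIntegral_le_integral (hint _ _).norm (ae_of_all _ fun _ => norm_nonneg _)
  · filter_upwards [hpos] with t ht
    obtain ⟨D, hD, hD'⟩ := hΦ.isSumming hq (p := p) (A t) (norm_nonneg (A t 1)) fun n f y =>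
      hΦ.sum_norm_le_of_isPositiveOp hp hpq hq ht f y
    refine ⟨D, hD, fun n f => ?_⟩
    rw [show p.toReal = q.toReal by rw [hpq']]
    exact hD' n f
  · -- For almost every `t`, the pairing with `A t` is bounded for the Chevet-Saphar norm; the
    -- summand `1` only makes the constant positive.
    have hbd : ∀ᵐ t ∂μ, ∀ z : C(K, ℂ) ⊗[ℂ] F,
        ‖tensorPairing (Φ ∘L A t) z‖ ≤ (‖A t 1‖ + 1) * chevetSaphar p q' z := by
      filter_upwards [hpos] with t ht z
      refine le_mul_chevetSaphar (by positivity) z fun n x y hz => ?_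
      rw [hz, tensorPairing_sum, ← mul_assoc]
      refine (norm_sum_le _ _).trans ((hΦ.sum_norm_le_of_isPositiveOp hp hpq hq ht x y).trans ?_)
      have := weakNorm_nonneg p x
      gcongr
      linarith
    have hcs : ∀ z, ∫ t, ‖tensorPairing (Φ ∘L A t) z‖ ∂μ ≤ C * chevetSaphar p q' z := fun z =>
      le_mul_chevetSaphar hC z fun n x y hz => by
        rw [hz, ← mul_assoc]
        exact (integral_norm_tensorPairing_le hint x y).trans (hweak n x y)
    have hlim : ∀ᵐ t ∂μ, ∃ c : ℂ,
        Tendsto (fun k => tensorPairing (Φ ∘L A t) (z k)) atTop (𝓝 c) := by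
      filter_upwards [hbd] with t ht
      refine cauchySeq_tendsto_of_complete ?_
      rw [Metric.cauchySeq_iff]
      intro ε hε
      have h0 : 0 < ‖A t 1‖ + 1 := by positivity
      obtain ⟨N, hN⟩ := hz (ε / (‖A t 1‖ + 1)) (by positivity)
      refine ⟨N, fun m hm n hn => ?_⟩
      rw [dist_eq_norm, ← map_sub]
      calc _ ≤ (‖A t 1‖ + 1) * chevetSaphar p q' (z m - z n) := ht _
        _ < (‖A t 1‖ + 1) * (ε / (‖A t 1‖ + 1)) := by gcongr; exact hN m hm n hn
        _ = ε := by field_simp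
    let g : Ω → ℂ := fun t => limUnder atTop fun k => tensorPairing (Φ ∘L A t) (z k)
    have hg : ∀ᵐ t ∂μ, Tendsto (fun k => tensorPairing (Φ ∘L A t) (z k)) atTop (𝓝 (g t)) := by
      filter_upwards [hlim] with t ht
      exact tendsto_nhds_limUnder ht
    exact ⟨g, (integrable_and_tendsto_of_isCauchyFor hpair hC hcs hz hg).1, hg⟩
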